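/- Let $1<p<\infty$ and let $N\ge 2$ be an integer. Let $\mathbb R^N_+=\{x\in\mathbb R^N: x_N>0\}$, and for $x\in\mathbb R^N_+$ let $r=|x|$ and let $\theta\in[0,\pi/2)$ be the angle between $x$ and the positive $x_N$-axis. A function $u$ is called $p$-harmonic in $\mathbb R^N_+$ if $u\in W^{1,p}_{\mathrm{loc}}(\mathbb R^N_+)$ and $\operatorname{div}(|\nabla u|^{p-2}\nabla u)=0$ in the weak sense, i.e. $\int_{\mathbb R^N_+}|\nabla u|^{p-2}\nabla u\cdot\nabla\varphi\,dx=0$ for all $\varphi\in C_c^\infty(\mathbb R^N_+)$. Then there is exactly one real number $k=k(p,N)<0$ for which there exists a function $f:[0,\pi/2]\to\mathbb R$ such that 1. $f$ is positive on $[0,\pi/2)$ and strictly decreasing on $[0,\pi/2]$; 2. $f\in C^2[0,\pi/2]$ (with one-sided derivatives at the end points); 3. $f(0)=1$, $f'(0)=0$, $f(\pi/2)=0$ and $-\infty<f'(\pi/2)<0$; 4. the quasiradial function $u(x)=r^kf(\theta)$ is $p$-harmonic in $\mathbb R^N_+$. -/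

import Mathlib

open scoped ContDiff
open MeasureTheory Set

noncomputable section

/-- `g` is a weak (distributional) gradient of `u` in the open set `Ω ⊆ ℝ^N`: for every smooth
compactly supported test function `φ` in `Ω` and every direction `v`,
`∫_Ω u ∂_v φ = - ∫_Ω φ ⟨g, v⟩`. -/
def IsWeakGradient {N : ℕ} (Ω : Set (EuclideanSpace ℝ (Fin N)))
    (u : EuclideanSpace ℝ (Fin N) → ℝ)
    (g : EuclideanSpace ℝ (Fin N) → EuclideanSpace ℝ (Fin N)) : Prop :=
  ∀ φ : EuclideanSpace ℝ (Fin N) → ℝ, ContDiff ℝ ∞ φ → HasCompactSupport φ → tsupport φ ⊆ Ω →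
    ∀ v : EuclideanSpace ℝ (Fin N),
      ∫ x in Ω, u x * fderiv ℝ φ x v = - ∫ x in Ω, φ x * inner ℝ (g x) v

/-- `h` is in `L^p_loc(Ω)`: it is in `L^p(K)` for every compact `K ⊆ Ω`. -/
def MemLpLoc {N : ℕ} {F : Type*} [NormedAddCommGroup F] (p : ℝ)
    (Ω : Set (EuclideanSpace ℝ (Fin N))) (h : EuclideanSpace ℝ (Fin N) → F) : Prop :=
  ∀ K : Set (EuclideanSpace ℝ (Fin N)), IsCompact K → K ⊆ Ω →
    MemLp h (ENNReal.ofReal p) (volume.restrict K)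

/-- `u` is `p`-harmonic in the open set `Ω`: `u ∈ W^{1,p}_loc(Ω)`, with weak gradient `g`, and
`div (|∇u|^{p-2} ∇u) = 0` weakly in `Ω`. -/
def IsPHarmonic {N : ℕ} (p : ℝ) (Ω : Set (EuclideanSpace ℝ (Fin N)))
    (u : EuclideanSpace ℝ (Fin N) → ℝ) : Prop :=
  ∃ g : EuclideanSpace ℝ (Fin N) → EuclideanSpace ℝ (Fin N),
    MemLpLoc p Ω u ∧ MemLpLoc p Ω g ∧ IsWeakGradient Ω u g ∧
    ∀ φ : EuclideanSpace ℝ (Fin N) → ℝ, ContDiff ℝ ∞ φ → HasCompactSupport φ → tsupport φ ⊆ Ω →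
      ∫ x in Ω, inner ℝ (‖g x‖ ^ (p - 2) • g x) (gradient φ x) = 0

/-- The index of the last coordinate `x_N` of `x ∈ ℝ^N`. -/
def lastIndex (N : ℕ) (hN : 2 ≤ N) : Fin N := ⟨N - 1, by omega⟩

/-- The upper half-space `ℝ^N_+ = {x : x_N > 0}`. -/
def upperHalfSpace (N : ℕ) (hN : 2 ≤ N) : Set (EuclideanSpace ℝ (Fin N)) :=
  {x | 0 < x (lastIndex N hN)}

/-- The quasiradial function `r^k f(θ)`, where `r = |x|` and `θ` is the angle between `x` and the
positive `x_N`-axis. -/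
def quasiradial (N : ℕ) (hN : 2 ≤ N) (k : ℝ) (f : ℝ → ℝ) (x : EuclideanSpace ℝ (Fin N)) : ℝ :=
  ‖x‖ ^ k * f (InnerProductGeometry.angle x (EuclideanSpace.single (lastIndex N hN) (1 : ℝ)))

/-- The conditions on the angular profile `f` on `[0, π/2]`; only the values of `f` on `[0, π/2]`
matter, and the derivatives at the end points are one-sided. -/
structure IsAngularProfile (f : ℝ → ℝ) : Prop where
  pos : ∀ θ ∈ Ico 0 (Real.pi / 2), 0 < f θ
  decreasing : StrictAntiOn f (Icc 0 (Real.pi / 2))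
  contDiffOn : ContDiffOn ℝ 2 f (Icc 0 (Real.pi / 2))
  value_zero : f 0 = 1
  deriv_zero : derivWithin f (Icc 0 (Real.pi / 2)) 0 = 0
  value_end : f (Real.pi / 2) = 0
  deriv_end : derivWithin f (Icc 0 (Real.pi / 2)) (Real.pi / 2) < 0

end

/-! Put `β = -k`, `q = p - 1`, `c = p - N`, `n = N - 2`. Off the axis, `r^(-β) f(θ)` with `f > 0` is
`p`-harmonic exactly when `f` solves a second-order equation, `angularOp = 0`, homogeneous in `(f,
f', f'')`. In the Prüfer variables `β f = ρ cos φ`, `f' = -ρ sin φ` it splits into a first-order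
equation for the phase `φ` alone and a quadrature for `ρ`. The boundary conditions become `φ(0) =
0`, `φ(π/2) = π/2`.

Existence of the phase is by shooting in `β`. The pole `θ = 0` is singular (`cot θ`), so the
equation is solved from the regular end in the reversed variables `τ = π/2 - θ`, `ψ = π/2 - φ`, with
`ψ(0) = 0`. The parameters for which `ψ` stays below `π/2` form, above a suitable `β₁`, a nonempty
closed bounded set. At its supremum `ψ` stays below `π/2`, while slightly larger parameters
overshoot. Comparison with lines then gives a linear rate `φ(θ) ≤ C θ` at the pole
(`exists_shooting_param`). L'Hôpital's rule upgrades the rate to differentiability of `φ` at `0`,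
whence a `C²` profile (`IsPhase.exists_profile`).

The flux of the resulting function is continuous across the axis but is only differentiated off it.
Cutoffs depending on the angle alone show that the axis contributes nothing to the weak equation
(`integral_homogeneous_field_eq_zero`). Conversely, a `p`-harmonic quasiradial function has its
classical gradient as weak gradient, and testing off the axis recovers the angular equation
pointwise (`IsRegularProfile.angularOp_eq_zero`).

For uniqueness, let `f`, `g` be profiles for `β < γ` and `w = log g / γ - log f / β`. Then `w(0) =
0` and `w → +∞` at `π/2`, so `w` has a minimum away from the right end of some `[0, b]`. There `w' =
0`, and the Riccati equation for `-f'/(β f)` makes `w''` negative, a contradiction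
(`IsAngularSolution.not_lt`). -/

open Filter Topology
open scoped NNReal

/-! ### Scalar ODEs on a symmetric open interval -/

/-- A scalar ODE whose right-hand side is bounded and uniformly Lipschitz on every compact
subinterval of `(-R, R)` has a solution on all of `(-R, R)`. -/
theorem exists_solution_Ioo {R x₀ : ℝ} (hR : 0 < R) {v : ℝ → ℝ → ℝ}
    (hlip : ∀ T < R, ∃ K : ℝ≥0, ∀ t ∈ Icc (-T) T, LipschitzWith K (v t))
    (hbd : ∀ T < R, ∃ L : ℝ≥0, ∀ t ∈ Icc (-T) T, ∀ x, ‖v t x‖ ≤ L)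
    (hcont : ∀ x, ContinuousOn (fun t => v t x) (Ioo (-R) R)) :
    ∃ y : ℝ → ℝ, y 0 = x₀ ∧ ∀ t ∈ Ioo (-R) R, HasDerivAt y (v t (y t)) t := by
  have loc : ∀ T : Ioo 0 R, ∃ y : ℝ → ℝ, y 0 = x₀ ∧
      ∀ t ∈ Icc (-(T : ℝ)) T, HasDerivWithinAt y (v t (y t)) (Icc (-(T : ℝ)) T) t := by
    rintro ⟨T, hT0, hTR⟩
    obtain ⟨K, hK⟩ := hlip T hTR
    obtain ⟨L, hL⟩ := hbd T hTR
    have hmem : (0 : ℝ) ∈ Icc (-T) T := ⟨by linarith, hT0.le⟩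
    -- The bounds hold for all `x`, so a ball of radius `L * T` cannot be left before time `T`.
    have : IsPicardLindelof v (tmin := -T) (tmax := T) ⟨0, hmem⟩ x₀ (L * T.toNNReal) 0 L K := by
      refine ⟨fun t ht => (hK t ht).lipschitzOnWith, fun x _ => (hcont x).mono ?_,
        fun t ht x _ => hL t ht x, ?_⟩
      · exact fun t ht => ⟨by linarith [ht.1], by linarith [ht.2]⟩
      · simp [hT0.le]
    exact this.exists_eq_forall_mem_Icc_hasDerivWithinAt₀
  choose y hy0 hy using loc
  have hder : ∀ (T : Ioo 0 R), ∀ t ∈ Ioo (-(T : ℝ)) T, HasDerivAt (y T) (v t (y T t)) t :=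
    fun T t ht => (hy T t (Ioo_subset_Icc_self ht)).hasDerivAt (Icc_mem_nhds ht.1 ht.2)
  have huniq : ∀ S T : Ioo 0 R, (S : ℝ) ≤ T → EqOn (y S) (y T) (Ioo (-(S : ℝ)) S) := by
    intro S T hST
    obtain ⟨K, hK⟩ := hlip S S.2.2
    refine ODE_solution_unique_of_mem_Ioo (v := v) (K := K) (s := fun _ => univ) (t₀ := 0)
      (fun t ht => (hK t (Ioo_subset_Icc_self ht)).lipschitzOnWith)
      ⟨by linarith [S.2.1], S.2.1⟩ (fun t ht => ⟨hder S t ht, mem_univ _⟩)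
      (fun t ht => ⟨hder T t ⟨by linarith [ht.1], by linarith [ht.2]⟩, mem_univ _⟩) ?_
    rw [hy0, hy0]
  have hmid : ∀ t ∈ Ioo (-R) R, (|t| + R) / 2 ∈ Ioo 0 R := by
    intro t ht
    have := abs_lt.2 ht
    exact ⟨by positivity, by linarith⟩
  -- Gluing: `(|t| + R) / 2` lies strictly between `|t|` and `R`, so its solution is defined around
  -- `t`.
  let z : ℝ → ℝ := fun t => if h : t ∈ Ioo (-R) R then y ⟨(|t| + R) / 2, hmid t h⟩ t else 0
  have hz : ∀ (T : Ioo 0 R), ∀ t ∈ Ioo (-(T : ℝ)) T, z t = y T t := by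
    intro T t ht
    have htR : t ∈ Ioo (-R) R := ⟨by linarith [ht.1, T.2.2], by linarith [ht.2, T.2.2]⟩
    have h1 : |t| < R := abs_lt.2 htR
    simp only [z, dif_pos htR]
    rcases le_total ((|t| + R) / 2) T with h | h
    · exact huniq ⟨_, hmid t htR⟩ T h
        (show t ∈ Ioo (-((|t| + R) / 2)) ((|t| + R) / 2) from abs_lt.1 (by linarith))
    · exact (huniq T ⟨_, hmid t htR⟩ h ht).symm
  refine ⟨z, ?_, fun t ht => ?_⟩
  · have h0 : (0 : ℝ) ∈ Ioo (-R) R := ⟨by linarith, hR⟩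
    rw [hz ⟨_, hmid 0 h0⟩ 0 (by simpa using hR), hy0]
  · have h1 : |t| < R := abs_lt.2 ht
    have hmem : t ∈ Ioo (-((|t| + R) / 2)) ((|t| + R) / 2) := abs_lt.1 (by linarith)
    have h2 := hder ⟨_, hmid t ht⟩ t hmem
    rw [hz ⟨_, hmid t ht⟩ t hmem]
    refine h2.congr_of_eventuallyEq ?_
    filter_upwards [Ioo_mem_nhds hmem.1 hmem.2] with s hs
    exact hz ⟨_, hmid t ht⟩ s hs

/-! ### The reversed phase equation: bounds, solvability, dependence on the parameter -/

/-- The slope of the reversed phase: `ψ' = phaseSlope q c n β τ ψ` for `ψ = π/2 - φ`,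
`τ = π/2 - θ`, where `β f = ρ cos φ`, `f' = -ρ sin φ`. -/
noncomputable def phaseSlope (q c n β τ x : ℝ) : ℝ :=
  (q * β + c * Real.sin x ^ 2 - n * Real.tan τ * (Real.sin x * Real.cos x)) /
    (Real.sin x ^ 2 + q * Real.cos x ^ 2)

theorem min_le_sin_sq_add (q x : ℝ) :
    min 1 q ≤ Real.sin x ^ 2 + q * Real.cos x ^ 2 := by
  have h := Real.sin_sq_add_cos_sq x
  rcases le_total 1 q with hq | hq
  · rw [min_eq_left hq]; nlinarith [sq_nonneg (Real.cos x)]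
  · rw [min_eq_right hq]; nlinarith [sq_nonneg (Real.sin x)]

theorem sin_sq_add_le_max (q x : ℝ) :
    Real.sin x ^ 2 + q * Real.cos x ^ 2 ≤ max 1 q := by
  have h := Real.sin_sq_add_cos_sq x
  rcases le_total 1 q with hq | hq
  · rw [max_eq_right hq]; nlinarith [sq_nonneg (Real.sin x)]
  · rw [max_eq_left hq]; nlinarith [sq_nonneg (Real.cos x)]

theorem sin_sq_add_pos {q : ℝ} (hq : 0 < q) (x : ℝ) :
    0 < Real.sin x ^ 2 + q * Real.cos x ^ 2 :=
  (lt_min one_pos hq).trans_le (min_le_sin_sq_add q x)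

theorem abs_sin_sq_sub_le (x y : ℝ) : |Real.sin x ^ 2 - Real.sin y ^ 2| ≤ |x - y| := by
  have h := Real.abs_cos_sub_cos_le (2 * y) (2 * x)
  have e : Real.sin x ^ 2 - Real.sin y ^ 2 = (Real.cos (2 * y) - Real.cos (2 * x)) / 2 := by
    rw [Real.cos_two_mul, Real.cos_two_mul, Real.cos_sq', Real.cos_sq']; ring
  have e2 : |2 * y - 2 * x| = 2 * |x - y| := by
    rw [← mul_sub, abs_mul, abs_sub_comm]; norm_num
  rw [e, abs_div, abs_two]
  linarith

theorem abs_sin_mul_cos_sub_le (x y : ℝ) :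
    |Real.sin x * Real.cos x - Real.sin y * Real.cos y| ≤ |x - y| := by
  have h := Real.abs_sin_sub_sin_le (2 * x) (2 * y)
  have e : Real.sin x * Real.cos x - Real.sin y * Real.cos y
      = (Real.sin (2 * x) - Real.sin (2 * y)) / 2 := by
    rw [Real.sin_two_mul, Real.sin_two_mul]; ring
  have e2 : |2 * x - 2 * y| = 2 * |x - y| := by
    rw [← mul_sub, abs_mul]; norm_num
  rw [e, abs_div, abs_two]
  linarith

theorem abs_sin_mul_cos_le (x : ℝ) : |Real.sin x * Real.cos x| ≤ 1 := by
  rw [abs_mul]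
  exact mul_le_one₀ (Real.abs_sin_le_one x) (abs_nonneg _) (Real.abs_cos_le_one x)

theorem abs_sin_sq_le (x : ℝ) : |Real.sin x ^ 2| ≤ 1 := by
  rw [abs_of_nonneg (sq_nonneg _)]; exact Real.sin_sq_le_one x

theorem abs_phaseNum_le (q c n β τ x : ℝ) :
    |q * β + c * Real.sin x ^ 2 - n * Real.tan τ * (Real.sin x * Real.cos x)|
      ≤ |q * β| + |c| + |n * Real.tan τ| := by
  refine (abs_sub _ _).trans (add_le_add ((abs_add_le _ _).trans (add_le_add le_rfl ?_)) ?_)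
  · rw [abs_mul]; exact mul_le_of_le_one_right (abs_nonneg _) (abs_sin_sq_le x)
  · rw [abs_mul]; exact mul_le_of_le_one_right (abs_nonneg _) (abs_sin_mul_cos_le x)

theorem abs_phaseSlope_le {q : ℝ} (hq : 0 < q) (c n β τ x : ℝ) :
    |phaseSlope q c n β τ x| ≤ (|q * β| + |c| + |n * Real.tan τ|) / min 1 q := by
  have hm : 0 < min 1 q := lt_min one_pos hq
  rw [phaseSlope, abs_div, abs_of_pos (sin_sq_add_pos hq x)]
  exact div_le_div₀ (by positivity) (abs_phaseNum_le ..) hm (min_le_sin_sq_add q x)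

/-- With slope `A / D`, the difference is `((A x - A y) * D y - A y * (D x - D y)) / (D x * D y)`,
and `D x - D y = (1 - q)(sin² x - sin² y)`. The constant depends on `τ` only through `|tan τ|`,
hence is uniform on compact subintervals of `(-π/2, π/2)`. -/
theorem abs_phaseSlope_sub_le {q : ℝ} (hq : 0 < q) (c n β τ x y : ℝ) :
    |phaseSlope q c n β τ x - phaseSlope q c n β τ y| ≤
      ((|c| + |n * Real.tan τ|) * max 1 q + (|q * β| + |c| + |n * Real.tan τ|) * |1 - q|) /
        (min 1 q * min 1 q) * |x - y| := by
  have hm : 0 < min 1 q := lt_min one_pos hq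
  have hx := sin_sq_add_pos hq x
  have hy := sin_sq_add_pos hq y
  have key : phaseSlope q c n β τ x - phaseSlope q c n β τ y =
      ((c * (Real.sin x ^ 2 - Real.sin y ^ 2) - n * Real.tan τ *
        (Real.sin x * Real.cos x - Real.sin y * Real.cos y)) *
          (Real.sin y ^ 2 + q * Real.cos y ^ 2) -
        (q * β + c * Real.sin y ^ 2 - n * Real.tan τ * (Real.sin y * Real.cos y)) *
          ((1 - q) * (Real.sin x ^ 2 - Real.sin y ^ 2))) /
      ((Real.sin x ^ 2 + q * Real.cos x ^ 2) * (Real.sin y ^ 2 + q * Real.cos y ^ 2)) := by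
    rw [phaseSlope, phaseSlope, div_sub_div _ _ hx.ne' hy.ne']
    congr 1
    rw [Real.cos_sq' x, Real.cos_sq' y]
    ring
  rw [key, abs_div, abs_of_pos (mul_pos hx hy), div_mul_eq_mul_div]
  refine div_le_div₀ (by positivity) ?_ (by positivity)
    (mul_le_mul (min_le_sin_sq_add q x) (min_le_sin_sq_add q y) hm.le hx.le)
  refine (abs_sub _ _).trans ((add_le_add (b := (|c| + |n * Real.tan τ|) * |x - y| * max 1 q)
    (d := (|q * β| + |c| + |n * Real.tan τ|) * (|1 - q| * |x - y|)) ?_ ?_).trans_eq (by ring))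
  · rw [abs_mul, abs_of_pos hy]
    refine mul_le_mul ?_ (sin_sq_add_le_max q y) hy.le (by positivity)
    refine (abs_sub _ _).trans ?_
    rw [abs_mul, abs_mul (n * _), add_mul]
    exact add_le_add (mul_le_mul_of_nonneg_left (abs_sin_sq_sub_le x y) (abs_nonneg _))
      (mul_le_mul_of_nonneg_left (abs_sin_mul_cos_sub_le x y) (abs_nonneg _))
  · rw [abs_mul, abs_mul (1 - q)]
    exact mul_le_mul (abs_phaseNum_le ..)
      (mul_le_mul_of_nonneg_left (abs_sin_sq_sub_le x y) (abs_nonneg _))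
      (by positivity) (by positivity)

theorem abs_tan_le_of_mem_Icc {T t : ℝ} (hT : T < Real.pi / 2) (ht : t ∈ Icc (-T) T) :
    |Real.tan t| ≤ Real.tan T := by
  have hT0 : -T ≤ T := ht.1.trans ht.2
  have hmono := Real.strictMonoOn_tan.monotoneOn
  have hmT : T ∈ Ioo (-(Real.pi / 2)) (Real.pi / 2) :=
    ⟨by linarith [Real.pi_pos], hT⟩
  have hmT' : -T ∈ Ioo (-(Real.pi / 2)) (Real.pi / 2) :=
    ⟨by linarith [Real.pi_pos], by linarith [Real.pi_pos]⟩
  have hmt : t ∈ Ioo (-(Real.pi / 2)) (Real.pi / 2) :=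
    ⟨by linarith [ht.1, hmT'.1], by linarith [ht.2]⟩
  rw [abs_le, ← Real.tan_neg]
  exact ⟨hmono hmT' hmt ht.1, hmono hmt hmT ht.2⟩

theorem lipschitzWith_phaseSlope {q : ℝ} (hq : 0 < q) (c n β : ℝ) {T : ℝ} (hT : T < Real.pi / 2) :
    ∃ K : ℝ≥0, ∀ t ∈ Icc (-T) T, LipschitzWith K (phaseSlope q c n β t) := by
  have hm : 0 < min 1 q := lt_min one_pos hq
  refine ⟨(((|c| + |n| * |Real.tan T|) * max 1 q + (|q * β| + |c| + |n| * |Real.tan T|) * |1 - q|) /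
        (min 1 q * min 1 q)).toNNReal, fun t ht => LipschitzWith.of_dist_le_mul fun x y => ?_⟩
  have h1 : |Real.tan t| ≤ |Real.tan T| := (abs_tan_le_of_mem_Icc hT ht).trans (le_abs_self _)
  have hmax : 0 < max 1 q := lt_max_of_lt_left one_pos
  rw [Real.dist_eq, Real.dist_eq, Real.coe_toNNReal _ (by positivity)]
  refine (abs_phaseSlope_sub_le hq c n β t x y).trans ?_
  rw [abs_mul n]
  gcongr

theorem bound_phaseSlope {q : ℝ} (hq : 0 < q) (c n β : ℝ) {T : ℝ} (hT : T < Real.pi / 2) :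
    ∃ K : ℝ≥0, ∀ t ∈ Icc (-T) T, ∀ x, ‖phaseSlope q c n β t x‖ ≤ K := by
  have hm : 0 < min 1 q := lt_min one_pos hq
  refine ⟨((|q * β| + |c| + |n| * |Real.tan T|) / min 1 q).toNNReal, fun t ht x => ?_⟩
  have h1 : |Real.tan t| ≤ |Real.tan T| := (abs_tan_le_of_mem_Icc hT ht).trans (le_abs_self _)
  rw [Real.norm_eq_abs, Real.coe_toNNReal _ (by positivity)]
  refine (abs_phaseSlope_le hq c n β t x).trans ?_
  rw [abs_mul n]
  gcongr

theorem exists_reversedPhase {q : ℝ} (hq : 0 < q) (c n β : ℝ) :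
    ∃ y : ℝ → ℝ, y 0 = 0 ∧ ∀ t ∈ Ioo (-(Real.pi / 2)) (Real.pi / 2),
      HasDerivAt y (phaseSlope q c n β t (y t)) t := by
  refine exists_solution_Ioo (by positivity) (fun T hT => lipschitzWith_phaseSlope hq c n β hT)
    (fun T hT => bound_phaseSlope hq c n β hT) fun x => ?_
  have : ContinuousOn Real.tan (Ioo (-(Real.pi / 2)) (Real.pi / 2)) := Real.continuousOn_tan_Ioo
  unfold phaseSlope
  fun_prop

/-- Continuous dependence of the reversed phase on the parameter `β`. -/
theorem continuous_reversedPhase {q : ℝ} (hq : 0 < q) {c n : ℝ} {y : ℝ → ℝ → ℝ}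
    (hy0 : ∀ β, y β 0 = 0)
    (hy : ∀ β, ∀ t ∈ Ioo (-(Real.pi / 2)) (Real.pi / 2),
      HasDerivAt (y β) (phaseSlope q c n β t (y β t)) t) {τ : ℝ} (hτ : τ ∈ Ico 0 (Real.pi / 2)) :
    Continuous fun β => y β τ := by
  have hm : 0 < min 1 q := lt_min one_pos hq
  rw [continuous_iff_continuousAt]
  intro β
  obtain ⟨K, hK⟩ := lipschitzWith_phaseSlope hq c n β hτ.2
  have hsub : ∀ t ∈ Icc 0 τ, t ∈ Ioo (-(Real.pi / 2)) (Real.pi / 2) := fun t ht =>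
    ⟨by linarith [ht.1, Real.pi_pos], by linarith [ht.2, hτ.2]⟩
  have bound : ∀ γ, dist (y γ τ) (y β τ) ≤
      gronwallBound 0 K (q * |γ - β| / min 1 q + 0) (τ - 0) := by
    intro γ
    refine dist_le_of_approx_trajectories_ODE_of_mem (v := phaseSlope q c n β)
      (s := fun _ => univ) (a := 0) (b := τ)
      (fun t ht => (hK t ⟨by linarith [ht.1, hτ.1], ht.2.le⟩).lipschitzOnWith)
      (fun t ht => (hy γ t (hsub t ht)).continuousAt.continuousWithinAt)
      (fun t ht => (hy γ t (hsub t (Ico_subset_Icc_self ht))).hasDerivWithinAt) ?_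
      (fun _ _ => mem_univ _)
      (fun t ht => (hy β t (hsub t ht)).continuousAt.continuousWithinAt)
      (fun t ht => (hy β t (hsub t (Ico_subset_Icc_self ht))).hasDerivWithinAt) ?_
      (fun _ _ => mem_univ _) ?_ τ ⟨hτ.1, le_rfl⟩
    · intro t _
      -- The parameter enters the numerator additively, so `y γ` solves the equation for `β` up to
      -- an error of size `q |γ - β| / min 1 q`; Grönwall does the rest.
      have e : phaseSlope q c n γ t (y γ t) - phaseSlope q c n β t (y γ t) =
          q * (γ - β) / (Real.sin (y γ t) ^ 2 + q * Real.cos (y γ t) ^ 2) := by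
        simp only [phaseSlope]; rw [← sub_div]; congr 1; ring
      rw [Real.dist_eq, e, abs_div, abs_mul, abs_of_pos hq, abs_of_pos (sin_sq_add_pos hq _)]
      exact div_le_div_of_nonneg_left (by positivity) hm (min_le_sin_sq_add q _)
    · intro t _; simp
    · simp [hy0]
  have hlim : Tendsto (fun γ => gronwallBound 0 K (q * |γ - β| / min 1 q + 0) (τ - 0)) (𝓝 β)
      (𝓝 0) := by
    have h1 : Continuous fun γ => gronwallBound 0 K (q * |γ - β| / min 1 q + 0) (τ - 0) :=
      (gronwallBound_continuous_ε 0 K (τ - 0)).comp (by fun_prop)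
    have := h1.tendsto β
    simpa [gronwallBound_ε0_δ0] using this
  rw [ContinuousAt, tendsto_iff_dist_tendsto_zero]
  exact squeeze_zero (fun _ => dist_nonneg) bound hlim

/-! ### Barriers for the reversed phase -/

/-- `y` solves the reversed phase equation with `y 0 = 0`. -/
structure IsReversedPhase (q c n β : ℝ) (y : ℝ → ℝ) : Prop where
  zero : y 0 = 0
  deriv : ∀ t ∈ Ioo (-(Real.pi / 2)) (Real.pi / 2), HasDerivAt y (phaseSlope q c n β t (y t)) t

/-- The `tan τ` term has a favourable sign in the strip `[0, π/2]`. Upper barriers therefore survive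
up to the singular end `τ = π/2`. -/
theorem phaseSlope_le {q c n β τ x : ℝ} (hq : 0 < q) (hn : 0 ≤ n) (hτ : τ ∈ Ico 0 (Real.pi / 2))
    (hx : x ∈ Icc 0 (Real.pi / 2)) :
    phaseSlope q c n β τ x ≤ (q * β + c * Real.sin x ^ 2) /
      (Real.sin x ^ 2 + q * Real.cos x ^ 2) := by
  have h1 : 0 ≤ Real.tan τ := Real.tan_nonneg_of_nonneg_of_le_pi_div_two hτ.1 hτ.2.le
  have h2 : 0 ≤ Real.sin x := Real.sin_nonneg_of_nonneg_of_le_pi hx.1 (by linarith [hx.2, Real.pi_pos])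
  have h3 : 0 ≤ Real.cos x := Real.cos_nonneg_of_neg_pi_div_two_le_of_le
    (by linarith [hx.1, Real.pi_pos]) hx.2
  have : 0 ≤ n * Real.tan τ * (Real.sin x * Real.cos x) := by positivity
  exact div_le_div_of_nonneg_right (by linarith) (sin_sq_add_pos hq x).le

theorem div_sin_sq_add_lt {q x a ε : ℝ} (hq : 0 < q) (hε : 0 < ε) (ha : a < ε * min 1 q) :
    a / (Real.sin x ^ 2 + q * Real.cos x ^ 2) < ε := by
  rw [div_lt_iff₀ (sin_sq_add_pos hq x)]
  exact ha.trans_le (mul_le_mul_of_nonneg_left (min_le_sin_sq_add q x) hε.le)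

namespace IsReversedPhase

variable {q c n β : ℝ} {y : ℝ → ℝ}

theorem hasDerivAt (h : IsReversedPhase q c n β y) {t : ℝ} (ht : t ∈ Ico 0 (Real.pi / 2)) :
    HasDerivAt y (phaseSlope q c n β t (y t)) t :=
  h.deriv t ⟨by linarith [ht.1, Real.pi_pos], ht.2⟩

theorem continuousOn (h : IsReversedPhase q c n β y) : ContinuousOn y (Ico 0 (Real.pi / 2)) :=
  fun _ ht => (h.hasDerivAt ht).continuousAt.continuousWithinAt

/-- Zero is a lower barrier: the slope at height `0` is `β > 0` at every time. -/
theorem nonneg (h : IsReversedPhase q c n β y) (hq : 0 < q) (hβ : 0 < β) {t : ℝ}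
    (ht : t ∈ Ico 0 (Real.pi / 2)) : 0 ≤ y t := by
  have hsub : ∀ s ∈ Icc 0 t, s ∈ Ico 0 (Real.pi / 2) := fun s hs => ⟨hs.1, hs.2.trans_lt ht.2⟩
  refine image_le_of_deriv_right_lt_deriv_boundary' (f := fun _ => 0) (f' := fun _ => 0)
    (B := y) (B' := fun s => phaseSlope q c n β s (y s)) (a := 0) (b := t) continuousOn_const
    (fun _ _ => hasDerivWithinAt_const _ _ _) h.zero.ge (h.continuousOn.mono hsub)
    (fun s hs => (h.hasDerivAt (hsub s (Ico_subset_Icc_self hs))).hasDerivWithinAt) ?_ ⟨ht.1, le_rfl⟩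
  intro s _ hs
  have : phaseSlope q c n β s 0 = β := by simp [phaseSlope, hq.ne']
  rw [← hs, this]; exact hβ

theorem pos (h : IsReversedPhase q c n β y) (hq : 0 < q) (hβ : 0 < β) {t : ℝ}
    (ht : t ∈ Ioo 0 (Real.pi / 2)) : 0 < y t := by
  refine (h.nonneg hq hβ (Ioo_subset_Ico_self ht)).lt_of_ne fun h0 => ?_
  have hmin : IsLocalMin y t := by
    filter_upwards [Ioo_mem_nhds ht.1 ht.2] with s hs
    rw [← h0]; exact h.nonneg hq hβ (Ioo_subset_Ico_self hs)
  have h1 := hmin.hasDerivAt_eq_zero (h.hasDerivAt (Ioo_subset_Ico_self ht))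
  rw [← h0] at h1
  have : phaseSlope q c n β t 0 = β := by simp [phaseSlope, hq.ne']
  linarith

/-- An interior contact with `π/2` would be a local maximum, but the slope at height `π/2` is `q β +
c > 0`. -/
theorem lt_pi_div_two (h : IsReversedPhase q c n β y) (hκ : 0 < q * β + c)
    (hle : ∀ t ∈ Ico 0 (Real.pi / 2), y t ≤ Real.pi / 2) {t : ℝ}
    (ht : t ∈ Ioo 0 (Real.pi / 2)) : y t < Real.pi / 2 := by
  refine (hle t (Ioo_subset_Ico_self ht)).lt_of_ne fun h0 => ?_
  have hmax : IsLocalMax y t := by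
    filter_upwards [Ioo_mem_nhds ht.1 ht.2] with s hs
    rw [h0]; exact hle s (Ioo_subset_Ico_self hs)
  have h1 := hmax.hasDerivAt_eq_zero (h.hasDerivAt (Ioo_subset_Ico_self ht))
  rw [h0] at h1
  have : phaseSlope q c n β t (Real.pi / 2) = q * β + c := by simp [phaseSlope]
  linarith

/-- Below `π/2` the reversed phase has bounded speed. -/
theorem le_line (h : IsReversedPhase q c n β y) (hq : 0 < q) (hn : 0 ≤ n) (hβ : 0 < β) {C : ℝ}
    (hC0 : 0 < C) (hC : q * β + |c| < C * min 1 q) {a t : ℝ} (ha : a ∈ Ico 0 (Real.pi / 2))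
    (hya : y a ≤ Real.pi / 2 - C * (Real.pi / 2 - a)) (ht : t ∈ Ico a (Real.pi / 2)) :
    y t ≤ Real.pi / 2 - C * (Real.pi / 2 - t) := by
  have hsub : ∀ s ∈ Icc a t, s ∈ Ico 0 (Real.pi / 2) := fun s hs =>
    ⟨ha.1.trans hs.1, hs.2.trans_lt ht.2⟩
  refine image_le_of_deriv_right_lt_deriv_boundary (f := y)
    (f' := fun s => phaseSlope q c n β s (y s))
    (B := fun s => Real.pi / 2 - C * (Real.pi / 2 - s)) (B' := fun _ => C) (a := a) (b := t)
    (h.continuousOn.mono hsub)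
    (fun s hs => (h.hasDerivAt (hsub s (Ico_subset_Icc_self hs))).hasDerivWithinAt) hya ?_ ?_
    ⟨ht.1, le_rfl⟩
  · intro s
    have := (((hasDerivAt_id s).const_sub (Real.pi / 2)).const_mul C).const_sub (Real.pi / 2)
    simpa using this
  · intro s hs hys
    have hs' := hsub s (Ico_subset_Icc_self hs)
    -- The line lies below `π/2`, so at a contact point the phase is in the strip where
    -- `phaseSlope_le` applies.
    have h1 : 0 < C * (Real.pi / 2 - s) := mul_pos hC0 (by linarith [hs'.2])
    refine (phaseSlope_le hq hn hs' ⟨h.nonneg hq hβ hs', by linarith⟩).trans_lt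
      (div_sin_sq_add_lt hq hC0 (lt_of_le_of_lt ?_ hC))
    have h2 := Real.sin_sq_le_one (y s)
    have h3 : c * Real.sin (y s) ^ 2 ≤ |c| * Real.sin (y s) ^ 2 :=
      mul_le_mul_of_nonneg_right (le_abs_self c) (sq_nonneg _)
    nlinarith [abs_nonneg c]

/-- Comparison of the reversed phase with a line of slope `ε` lying in the strip `[0, π/2]`. -/
theorem le_of_slope (h : IsReversedPhase q c n β y) (hq : 0 < q) (hn : 0 ≤ n) {ε b : ℝ}
    (hε : 0 < ε) (hb : 0 ≤ b) (hb' : b + ε * (Real.pi / 2) ≤ Real.pi / 2)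
    (hsl : ∀ s ∈ Ico 0 (Real.pi / 2), q * β + c * Real.sin (b + ε * s) ^ 2 < ε * min 1 q) {t : ℝ}
    (ht : t ∈ Ico 0 (Real.pi / 2)) : y t ≤ Real.pi / 2 := by
  have hsub : ∀ s ∈ Icc 0 t, s ∈ Ico 0 (Real.pi / 2) := fun s hs => ⟨hs.1, hs.2.trans_lt ht.2⟩
  have key : y t ≤ b + ε * t := by
    refine image_le_of_deriv_right_lt_deriv_boundary (f := y)
      (f' := fun s => phaseSlope q c n β s (y s))
      (B := fun s => b + ε * s) (B' := fun _ => ε) (a := 0) (b := t)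
      (h.continuousOn.mono hsub)
      (fun s hs => (h.hasDerivAt (hsub s (Ico_subset_Icc_self hs))).hasDerivWithinAt)
      (by simpa [h.zero] using hb) ?_ ?_ ⟨ht.1, le_rfl⟩
    · intro s
      simpa using ((hasDerivAt_id s).const_mul ε).const_add b
    · intro s hs hys
      have hs' := hsub s (Ico_subset_Icc_self hs)
      have h1 : ε * s ≤ ε * (Real.pi / 2) := mul_le_mul_of_nonneg_left hs'.2.le hε.le
      have h2 : 0 ≤ ε * s := mul_nonneg hε.le hs'.1
      rw [hys]
      exact (phaseSlope_le hq hn hs' ⟨by linarith, by linarith⟩).trans_lt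
        (div_sin_sq_add_lt hq hε (hsl s hs'))
  have h1 : ε * t ≤ ε * (Real.pi / 2) := mul_le_mul_of_nonneg_left ht.2.le hε.le
  linarith

/-- If the reversed phase stays in `[0, π/2]` then `β` is bounded. -/
theorem param_le (h : IsReversedPhase q c n β y) (hq : 0 < q) (hn : 0 ≤ n)
    (hle : ∀ t ∈ Ico 0 (Real.pi / 2), y t ≤ Real.pi / 2) :
    q * β ≤ |c| + n + 2 * max 1 q := by
  by_contra! hlt
  have hmax : 0 < max 1 q := lt_max_of_lt_left one_pos
  have hpi := Real.pi_pos
  have hsub : ∀ s ∈ Icc 0 (Real.pi / 4), s ∈ Ico 0 (Real.pi / 2) := fun s hs =>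
    ⟨hs.1, hs.2.trans_lt (by linarith)⟩
  -- On `[0, π/4]` one has `tan ≤ 1`, so a large `β` forces slope above `2` and the phase would
  -- reach `π/2` by time `π/4`.
  have key : ∀ ⦃s⦄, s ∈ Icc 0 (Real.pi / 4) → 2 * s ≤ y s := by
    refine image_le_of_deriv_right_lt_deriv_boundary' (f := fun s => 2 * s) (f' := fun _ => 2)
      (B := y) (B' := fun s => phaseSlope q c n β s (y s)) (by fun_prop)
      (fun s _ => ?_) (by simp [h.zero]) (h.continuousOn.mono hsub)
      (fun s hs => (h.hasDerivAt (hsub s (Ico_subset_Icc_self hs))).hasDerivWithinAt) ?_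
    · simpa using ((hasDerivAt_id s).const_mul 2).hasDerivWithinAt
    · intro s hs _
      have h1 : |Real.tan s| ≤ 1 := by
        have := abs_tan_le_of_mem_Icc (T := Real.pi / 4) (t := s) (by linarith)
          ⟨by linarith [hs.1], hs.2.le⟩
        rwa [Real.tan_pi_div_four] at this
      rw [phaseSlope, lt_div_iff₀ (sin_sq_add_pos hq _)]
      have h2 := sin_sq_add_le_max q (y s)
      have h3 : |c * Real.sin (y s) ^ 2| ≤ |c| := by
        rw [abs_mul]; exact mul_le_of_le_one_right (abs_nonneg _) (abs_sin_sq_le _)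
      have h4 : |n * Real.tan s * (Real.sin (y s) * Real.cos (y s))| ≤ n := by
        rw [abs_mul, abs_mul, abs_of_nonneg hn, mul_assoc]
        exact mul_le_of_le_one_right hn (mul_le_one₀ h1 (abs_nonneg _) (abs_sin_mul_cos_le _))
      linarith [abs_le.1 h3, abs_le.1 h4]
  have h1 := key (s := Real.pi / 4) ⟨by linarith, le_rfl⟩
  have hcont : y (Real.pi / 4) < Real.pi / 2 ∨ y (Real.pi / 4) = Real.pi / 2 :=
    (hle _ (hsub _ ⟨by linarith, le_rfl⟩)).lt_or_eq
  rcases hcont with h2 | h2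
  · linarith
  · have hmax : IsLocalMax y (Real.pi / 4) := by
      filter_upwards [Ioo_mem_nhds (show 0 < Real.pi / 4 by linarith)
        (show Real.pi / 4 < Real.pi / 2 by linarith)] with s hs
      rw [h2]; exact hle s (Ioo_subset_Ico_self hs)
    have h3 := hmax.hasDerivAt_eq_zero (h.hasDerivAt (hsub _ ⟨by linarith, le_rfl⟩))
    rw [h2] at h3
    have : phaseSlope q c n β (Real.pi / 4) (Real.pi / 2) = q * β + c := by simp [phaseSlope]
    linarith [neg_abs_le c]

end IsReversedPhase

/-! ### The shooting argument -/

/-- This gives an admissible starting parameter with a line of slope `ε` as upper barrier. The `c`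
term costs `O(ε²)` along a suitable line while the allowance is linear in `ε`. For `c ≥ 0` the line
starts at `0`, where `sin` is small. For `c ≤ 0` take `β = δ - c / q`, so that `q β + c sin² = q δ +
|c| cos²`, and let the line end at `π/2`, where `cos` is small. -/
theorem exists_small_param {q : ℝ} (hq : 0 < q) (c : ℝ) :
    ∃ β, 0 < β ∧ 0 < q * β + c ∧ ∃ ε b : ℝ, 0 < ε ∧ 0 ≤ b ∧ b + ε * (Real.pi / 2) ≤ Real.pi / 2 ∧
      ∀ s ∈ Ico 0 (Real.pi / 2), q * β + c * Real.sin (b + ε * s) ^ 2 < ε * min 1 q := by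
  have hm : 0 < min 1 q := lt_min one_pos hq
  have hpi := Real.pi_pos
  obtain ⟨ε, hε0, hε1, hε⟩ : ∃ ε : ℝ, 0 < ε ∧ ε ≤ 1 ∧
      |c| * (ε * (Real.pi / 2)) ^ 2 ≤ ε * min 1 q / 2 := by
    have hd : 0 < 1 + |c| * (Real.pi / 2) ^ 2 * 2 / min 1 q := by positivity
    refine ⟨1 / (1 + |c| * (Real.pi / 2) ^ 2 * 2 / min 1 q), by positivity, ?_, ?_⟩
    · rw [div_le_one hd]
      have : 0 ≤ |c| * (Real.pi / 2) ^ 2 * 2 / min 1 q := by positivity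
      linarith
    · set d := 1 + |c| * (Real.pi / 2) ^ 2 * 2 / min 1 q with hdef
      have h1 : |c| * (Real.pi / 2) ^ 2 = (d - 1) * min 1 q / 2 := by
        rw [hdef]; field_simp; ring
      have h2 : |c| * (1 / d * (Real.pi / 2)) ^ 2 = (1 / d) * ((d - 1) / d) * (min 1 q / 2) := by
        rw [mul_pow, mul_left_comm, h1]; field_simp
      rw [h2]
      have h3 : (d - 1) / d ≤ 1 := by rw [div_le_one hd]; linarith
      have h4 : (0:ℝ) < 1 / d := by positivity
      nlinarith [mul_pos h4 hm]
  set δ := ε * min 1 q / (4 * q) with hδ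
  have hδ0 : 0 < δ := by positivity
  have hqδ : q * δ < ε * min 1 q / 2 := by
    have : q * δ = ε * min 1 q / 4 := by rw [hδ]; field_simp
    rw [this]; have := mul_pos hε0 hm; linarith
  have hsin : ∀ z, 0 ≤ z → z ≤ ε * (Real.pi / 2) → Real.sin z ^ 2 ≤ (ε * (Real.pi / 2)) ^ 2 := by
    intro z hz0 hz
    rw [sq_le_sq, abs_of_nonneg (hz0.trans hz)]
    exact (Real.abs_sin_le_abs ..).trans (by rwa [abs_of_nonneg hz0])
  rcases le_total 0 c with hc | hc
  · refine ⟨δ, hδ0, by positivity, ε, 0, hε0, le_rfl, by nlinarith, fun s hs => ?_⟩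
    rw [abs_of_nonneg hc] at hε
    have := hsin (ε * s) (mul_nonneg hε0.le hs.1) (mul_le_mul_of_nonneg_left hs.2.le hε0.le)
    rw [zero_add]
    linarith [mul_le_mul_of_nonneg_left this hc]
  · refine ⟨δ - c / q, ?_, ?_, ε, Real.pi / 2 - ε * (Real.pi / 2), hε0, by nlinarith, by linarith,
      fun s hs => ?_⟩
    · linarith [div_nonpos_of_nonpos_of_nonneg hc hq.le]
    · rw [mul_sub, mul_div_cancel₀ _ hq.ne']; linarith [mul_pos hq hδ0]
    · rw [abs_of_nonpos hc] at hε
      have := hsin (ε * (Real.pi / 2) - ε * s)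
        (sub_nonneg.2 (mul_le_mul_of_nonneg_left hs.2.le hε0.le))
        (by linarith [mul_nonneg hε0.le hs.1])
      have e : Real.sin (Real.pi / 2 - ε * (Real.pi / 2) + ε * s) ^ 2 =
          1 - Real.sin (ε * (Real.pi / 2) - ε * s) ^ 2 := by
        rw [show Real.pi / 2 - ε * (Real.pi / 2) + ε * s =
          Real.pi / 2 - (ε * (Real.pi / 2) - ε * s) by ring, Real.sin_pi_div_two_sub, Real.cos_sq']
      rw [e, mul_sub, mul_div_cancel₀ _ hq.ne']
      linarith [mul_le_mul_of_nonneg_left this (neg_nonneg.2 hc)]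

/-- Shooting: for a suitable `β` the reversed phase runs through `(0, π/2)` and reaches `π/2`
exactly at `τ = π/2`, at a linear rate. -/
theorem exists_shooting_param {q : ℝ} (hq : 0 < q) (c : ℝ) {n : ℝ} (hn : 0 ≤ n) :
    ∃ β, 0 < β ∧ 0 < q * β + c ∧ ∃ y, IsReversedPhase q c n β y ∧
      (∀ t ∈ Ioo 0 (Real.pi / 2), 0 < y t ∧ y t < Real.pi / 2) ∧
      ∃ C, ∀ t ∈ Ioo 0 (Real.pi / 2), Real.pi / 2 - C * (Real.pi / 2 - t) ≤ y t := by
  have hm : 0 < min 1 q := lt_min one_pos hq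
  choose y hy0 hy using fun β => exists_reversedPhase hq c n β
  have hsol : ∀ β, IsReversedPhase q c n β (y β) := fun β => ⟨hy0 β, hy β⟩
  obtain ⟨β₁, hβ₁, hκ₁, ε, b, hε, hb, hb', hsl⟩ := exists_small_param hq c
  -- The constraint `β₁ ≤ β` guarantees `β > 0` and `q β + c > 0` throughout `S`.
  set S : Set ℝ := {β | β₁ ≤ β ∧ ∀ t ∈ Ico 0 (Real.pi / 2), y β t ≤ Real.pi / 2} with hS
  have hSne : S.Nonempty :=
    ⟨β₁, le_rfl, fun t ht => (hsol β₁).le_of_slope hq hn hε hb hb' hsl ht⟩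
  have hSbd : BddAbove S := ⟨(|c| + n + 2 * max 1 q) / q, fun β hβ => by
    rw [le_div_iff₀ hq, mul_comm]
    exact (hsol β).param_le hq hn hβ.2⟩
  have hSclosed : IsClosed S := by
    have : S = Ici β₁ ∩ ⋂ t ∈ Ico 0 (Real.pi / 2), {β | y β t ≤ Real.pi / 2} := by
      ext β; simp [hS]
    rw [this]
    exact isClosed_Ici.inter (isClosed_biInter fun t ht =>
      isClosed_le (continuous_reversedPhase hq hy0 hy ht) continuous_const)
  have hmem := hSclosed.csSup_mem hSne hSbd
  set β := sSup S with hβdef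
  have hβ0 : 0 < β := hβ₁.trans_le hmem.1
  have hκ : 0 < q * β + c := by nlinarith [mul_le_mul_of_nonneg_left hmem.1 hq.le]
  refine ⟨β, hβ0, hκ, y β, hsol β, fun t ht => ⟨(hsol β).pos hq hβ0 ht,
    (hsol β).lt_pi_div_two hκ hmem.2 ht⟩, (q * (β + 1) + |c|) / min 1 q, fun t ht => ?_⟩
  -- The `β + 1` makes one constant serve for every `γ` in `(β, β + 1)`. The bound is proved for
  -- these overshooting parameters and passes to the limit `γ → β`.
  set C := (q * (β + 1) + |c|) / min 1 q with hC
  have hC0 : 0 < C := by positivity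
  have htend : Tendsto (fun γ => y γ t) (𝓝[>] β) (𝓝 (y β t)) :=
    ((continuous_reversedPhase hq hy0 hy (Ioo_subset_Ico_self ht)).tendsto β).mono_left
      nhdsWithin_le_nhds
  refine ge_of_tendsto htend ?_
  filter_upwards [Ioo_mem_nhdsGT (show β < β + 1 by linarith)] with γ hγ
  by_contra! hlt
  have hγS : γ ∉ S := fun h => (le_csSup hSbd h).not_gt hγ.1
  have : ∃ s ∈ Ico 0 (Real.pi / 2), Real.pi / 2 < y γ s := by
    by_contra! hno
    exact hγS ⟨hmem.1.trans hγ.1.le, hno⟩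
  obtain ⟨s, hs, hys⟩ := this
  have hline : ∀ r ∈ Ico t (Real.pi / 2), y γ r ≤ Real.pi / 2 - C * (Real.pi / 2 - r) :=
    fun r hr => (hsol γ).le_line hq hn (hβ0.trans hγ.1) hC0
      (by rw [hC, div_mul_cancel₀ _ hm.ne']; nlinarith [hγ.2]) (Ioo_subset_Ico_self ht) hlt.le hr
  -- Overshooting after time `t` contradicts the line barrier started at `t`.
  rcases le_or_gt t s with hts | hts
  · have h1 := hline s ⟨hts, hs.2⟩
    have : 0 < C * (Real.pi / 2 - s) := mul_pos hC0 (by linarith [hs.2])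
    linarith
  · -- once above `π/2` the reversed phase stays above
    have hκγ : 0 < q * γ + c := by nlinarith [mul_lt_mul_of_pos_left hγ.1 hq]
    have hsub : ∀ r ∈ Icc s t, r ∈ Ico 0 (Real.pi / 2) := fun r hr =>
      ⟨hs.1.trans hr.1, hr.2.trans_lt ht.2⟩
    have key : Real.pi / 2 ≤ y γ t := by
      refine image_le_of_deriv_right_lt_deriv_boundary' (f := fun _ => Real.pi / 2)
        (f' := fun _ => 0) (B := y γ) (B' := fun r => phaseSlope q c n γ r (y γ r)) (a := s)
        (b := t) continuousOn_const (fun _ _ => hasDerivWithinAt_const _ _ _) hys.le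
        ((hsol γ).continuousOn.mono hsub)
        (fun r hr => ((hsol γ).hasDerivAt (hsub r (Ico_subset_Icc_self hr))).hasDerivWithinAt) ?_
        ⟨hts.le, le_rfl⟩
      intro r _ hr
      have : phaseSlope q c n γ r (Real.pi / 2) = q * γ + c := by simp [phaseSlope]
      rw [← hr, this]; exact hκγ
    have : 0 < C * (Real.pi / 2 - t) := mul_pos hC0 (by linarith [ht.2])
    linarith

/-! ### The angular equation and its solution by phase and amplitude -/

/-- The left-hand side of the angular equation. -/
noncomputable def angularOp (q c n β θ y y₁ y₂ : ℝ) : ℝ :=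
  (β ^ 2 * y ^ 2 + y₁ ^ 2 + (q - 1) * y₁ ^ 2) * y₂ + (q - 1) * β ^ 2 * y * y₁ ^ 2 +
    (n * (Real.cos θ / Real.sin θ) * y₁ + β * (q * β + c) * y) * (β ^ 2 * y ^ 2 + y₁ ^ 2)

/-- `f` is a `C²` solution on `[0, π/2]`, with derivatives `f₁`, `f₂`, of the angular equation
satisfied by the profile of `r^(-β) f(θ)`; here `q = p - 1`, `c = p - N`, `n = N - 2`. -/
structure IsAngularSolution (q c n β : ℝ) (f f₁ f₂ : ℝ → ℝ) : Prop where
  deriv : ∀ θ ∈ Icc 0 (Real.pi / 2), HasDerivWithinAt f (f₁ θ) (Icc 0 (Real.pi / 2)) θ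
  deriv₁ : ∀ θ ∈ Icc 0 (Real.pi / 2), HasDerivWithinAt f₁ (f₂ θ) (Icc 0 (Real.pi / 2)) θ
  cont₂ : ContinuousOn f₂ (Icc 0 (Real.pi / 2))
  ode : ∀ θ ∈ Ioo 0 (Real.pi / 2), angularOp q c n β θ (f θ) (f₁ θ) (f₂ θ) = 0
  zero : f 0 = 1
  zero₁ : f₁ 0 = 0

/-- The slope of the phase `φ`. -/
noncomputable def angleSlope (q c n β θ x : ℝ) : ℝ :=
  (q * β + c * Real.cos x ^ 2 - n * (Real.cos θ / Real.sin θ) * (Real.cos x * Real.sin x)) /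
    (Real.cos x ^ 2 + q * Real.sin x ^ 2)

/-- The logarithmic derivative of the amplitude. -/
noncomputable def amplitudeSlope (q c n β θ x : ℝ) : ℝ :=
  Real.sin x * (((q - 1) * β + c) * Real.cos x - n * (Real.cos θ / Real.sin θ) * Real.sin x) /
    (Real.cos x ^ 2 + q * Real.sin x ^ 2)

theorem cos_sq_add_pos {q : ℝ} (hq : 0 < q) (x : ℝ) :
    0 < Real.cos x ^ 2 + q * Real.sin x ^ 2 := by
  have := sin_sq_add_pos hq (Real.pi / 2 - x)
  rwa [Real.sin_pi_div_two_sub, Real.cos_pi_div_two_sub] at this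

theorem angleSlope_mul {q : ℝ} (hq : 0 < q) (c n β θ x : ℝ) :
    angleSlope q c n β θ x * (Real.cos x ^ 2 + q * Real.sin x ^ 2) =
      q * β + c * Real.cos x ^ 2 -
        n * (Real.cos θ / Real.sin θ) * (Real.cos x * Real.sin x) :=
  div_mul_cancel₀ _ (cos_sq_add_pos hq x).ne'

theorem amplitudeSlope_mul {q : ℝ} (hq : 0 < q) (c n β θ x : ℝ) :
    amplitudeSlope q c n β θ x * (Real.cos x ^ 2 + q * Real.sin x ^ 2) =
      Real.sin x * (((q - 1) * β + c) * Real.cos x -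
        n * (Real.cos θ / Real.sin θ) * Real.sin x) :=
  div_mul_cancel₀ _ (cos_sq_add_pos hq x).ne'

theorem phaseSlope_pi_div_two_sub (q c n β θ x : ℝ) :
    phaseSlope q c n β (Real.pi / 2 - θ) (Real.pi / 2 - x) = angleSlope q c n β θ x := by
  rw [phaseSlope, angleSlope, Real.sin_pi_div_two_sub, Real.cos_pi_div_two_sub,
    Real.tan_pi_div_two_sub, Real.tan_eq_sin_div_cos, inv_div]

/-- A phase function on `[0, π/2]`, vanishing linearly at `0`. -/
structure IsPhase (q c n β C : ℝ) (φ : ℝ → ℝ) : Prop where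
  zero : φ 0 = 0
  pi_div_two : φ (Real.pi / 2) = Real.pi / 2
  deriv : ∀ θ ∈ Ioc 0 (Real.pi / 2), HasDerivAt φ (angleSlope q c n β θ (φ θ)) θ
  pos : ∀ θ ∈ Ioo 0 (Real.pi / 2), 0 < φ θ
  lt : ∀ θ ∈ Ioo 0 (Real.pi / 2), φ θ < Real.pi / 2
  le : ∀ θ ∈ Ioo 0 (Real.pi / 2), φ θ ≤ C * θ

theorem exists_isPhase {q : ℝ} (hq : 0 < q) (c : ℝ) {n : ℝ} (hn : 0 ≤ n) :
    ∃ β, 0 < β ∧ 0 < q * β + c ∧ ∃ C φ, IsPhase q c n β C φ := by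
  obtain ⟨β, hβ, hκ, y, hy, hyb, C, hC⟩ := exists_shooting_param hq c hn
  have hpi := Real.pi_pos
  -- The value at `0` is prescribed because nothing is known about `y` at `π/2`. At `θ = π/2` a
  -- two-sided derivative is available, as `y` solves its equation on both sides of `τ = 0`.
  refine ⟨β, hβ, hκ, C, fun θ => if θ ≤ 0 then 0 else Real.pi / 2 - y (Real.pi / 2 - θ), ?_⟩
  have hrefl : ∀ θ ∈ Ioo 0 (Real.pi / 2), Real.pi / 2 - θ ∈ Ioo 0 (Real.pi / 2) := fun θ hθ =>
    ⟨by linarith [hθ.2], by linarith [hθ.1]⟩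
  refine ⟨by simp, ?_, fun θ hθ => ?_, fun θ hθ => ?_, fun θ hθ => ?_, fun θ hθ => ?_⟩
  · rw [if_neg (by linarith), sub_self, hy.zero, sub_zero]
  · have h1 := hy.deriv (Real.pi / 2 - θ) ⟨by linarith [hθ.2], by linarith [hθ.1]⟩
    have h2 := (h1.comp θ ((hasDerivAt_id θ).const_sub (Real.pi / 2))).const_sub (Real.pi / 2)
    rw [if_neg hθ.1.not_ge, ← phaseSlope_pi_div_two_sub, sub_sub_cancel]
    refine HasDerivAt.congr_of_eventuallyEq (f := fun s => Real.pi / 2 - y (Real.pi / 2 - s)) ?_ ?_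
    · simpa [Function.comp_def] using h2
    · filter_upwards [Ioi_mem_nhds hθ.1] with s hs
      rw [if_neg (not_le.2 hs)]
  · rw [if_neg hθ.1.not_ge]; linarith [(hyb _ (hrefl θ hθ)).2]
  · rw [if_neg hθ.1.not_ge]; linarith [(hyb _ (hrefl θ hθ)).1]
  · rw [if_neg hθ.1.not_ge]
    have := hC _ (hrefl θ hθ)
    rw [sub_sub_cancel] at this; linarith

namespace IsPhase

variable {q c β C : ℝ} {n : ℕ} {φ : ℝ → ℝ}

theorem eventually_mem_Ioo : ∀ᶠ θ in 𝓝[>] (0 : ℝ), θ ∈ Ioo 0 (Real.pi / 2) :=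
  Ioo_mem_nhdsGT (by positivity)

theorem tendsto_zero (h : IsPhase q c n β C φ) : Tendsto φ (𝓝[>] 0) (𝓝 0) := by
  have h1 : Tendsto (fun θ : ℝ => C * θ) (𝓝[>] 0) (𝓝 0) := by
    have : Continuous fun θ : ℝ => C * θ := by fun_prop
    simpa using (this.tendsto 0).mono_left nhdsWithin_le_nhds
  refine tendsto_of_tendsto_of_tendsto_of_le_of_le' tendsto_const_nhds h1 ?_ ?_
  · filter_upwards [eventually_mem_Ioo] with θ hθ using (h.pos θ hθ).le
  · filter_upwards [eventually_mem_Ioo] with θ hθ using h.le θ hθ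

/-- Writing sines through `sinc` isolates the singular term as `φ / θ` times a factor tending to
`1`. -/
theorem cot_mul_sin (h : IsPhase q c n β C φ) {θ : ℝ} (hθ : θ ∈ Ioo 0 (Real.pi / 2)) :
    Real.cos θ / Real.sin θ * Real.sin (φ θ) =
      φ θ / θ * (Real.cos θ * Real.sinc (φ θ) / Real.sinc θ) := by
  have h1 := h.pos θ hθ
  have h2 : Real.sin θ ≠ 0 :=
    (Real.sin_pos_of_pos_of_lt_pi hθ.1 (by linarith [hθ.2, Real.pi_pos])).ne'
  rw [Real.sinc_of_ne_zero h1.ne', Real.sinc_of_ne_zero hθ.1.ne']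
  have := hθ.1.ne'
  field_simp

theorem tendsto_sinc_ratio (h : IsPhase q c n β C φ) :
    Tendsto (fun θ => Real.cos θ * Real.sinc (φ θ) / Real.sinc θ) (𝓝[>] 0) (𝓝 1) := by
  have hid : Tendsto (fun θ : ℝ => θ) (𝓝[>] 0) (𝓝 0) := nhdsWithin_le_nhds
  have h1 := ((Real.continuous_cos.tendsto 0).comp hid).mul
    ((Real.continuous_sinc.tendsto 0).comp h.tendsto_zero)
  have h2 := h1.div ((Real.continuous_sinc.tendsto 0).comp hid) (by simp)
  simp only [Real.cos_zero, Real.sinc_zero, mul_one, div_one] at h2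
  exact h2

theorem tendsto_denom (h : IsPhase q c n β C φ) :
    Tendsto (fun θ => Real.cos (φ θ) ^ 2 + q * Real.sin (φ θ) ^ 2) (𝓝[>] 0) (𝓝 1) := by
  have : Continuous fun x => Real.cos x ^ 2 + q * Real.sin x ^ 2 := by fun_prop
  simpa [Function.comp_def] using (this.tendsto 0).comp h.tendsto_zero

/-- Replacing the singular term by `n φ / θ` makes an error `φ / θ * o(1)`. This vanishes in the
limit because the linear rate from shooting keeps `φ / θ` bounded. -/
theorem tendsto_slope_add (h : IsPhase q c n β C φ) :
    Tendsto (fun θ => n * (φ θ / θ) + angleSlope q c n β θ (φ θ)) (𝓝[>] 0) (𝓝 (q * β + c)) := by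
  have hcos : Tendsto (fun θ => Real.cos (φ θ)) (𝓝[>] 0) (𝓝 1) := by
    simpa [Function.comp_def] using (Real.continuous_cos.tendsto 0).comp h.tendsto_zero
  have h1 : Tendsto (fun θ => (q * β + c * Real.cos (φ θ) ^ 2) /
      (Real.cos (φ θ) ^ 2 + q * Real.sin (φ θ) ^ 2)) (𝓝[>] 0) (𝓝 (q * β + c)) := by
    have := (((hcos.pow 2).const_mul c).const_add (q * β)).div h.tendsto_denom one_ne_zero
    simp only [one_pow, mul_one, div_one] at this
    exact this
  have h2 : Tendsto (fun θ => φ θ / θ * (n * (1 - Real.cos θ * Real.sinc (φ θ) / Real.sinc θ *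
      Real.cos (φ θ) / (Real.cos (φ θ) ^ 2 + q * Real.sin (φ θ) ^ 2)))) (𝓝[>] 0) (𝓝 0) := by
    refine bdd_le_mul_tendsto_zero' C ?_ ?_
    · filter_upwards [eventually_mem_Ioo] with θ hθ
      rw [abs_of_pos (div_pos (h.pos θ hθ) hθ.1), div_le_iff₀ hθ.1]
      exact h.le θ hθ
    · have := ((((h.tendsto_sinc_ratio.mul hcos).div h.tendsto_denom one_ne_zero).const_sub
        1).const_mul (n : ℝ))
      simpa using this
  have h3 := h1.add h2
  rw [add_zero] at h3
  refine h3.congr' ?_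
  filter_upwards [eventually_mem_Ioo] with θ hθ
  rw [angleSlope, show (n : ℝ) * (Real.cos θ / Real.sin θ) * (Real.cos (φ θ) * Real.sin (φ θ)) =
    n * Real.cos (φ θ) * (Real.cos θ / Real.sin θ * Real.sin (φ θ)) by ring, h.cot_mul_sin hθ]
  ring

/-- L'Hôpital's rule is applied to `θ^n φ / θ^(n+1)`: the quotient of derivatives is `(n φ / θ + φ')
/ (n + 1)`, whose limit is known although neither summand's is yet. -/
theorem tendsto_div (h : IsPhase q c n β C φ) :
    Tendsto (fun θ => φ θ / θ) (𝓝[>] 0) (𝓝 ((q * β + c) / (n + 1))) := by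
  have hn : (n : ℝ) + 1 ≠ 0 := by positivity
  have hid : Tendsto (fun θ : ℝ => θ) (𝓝[>] 0) (𝓝 0) := nhdsWithin_le_nhds
  have key : Tendsto (fun θ => θ ^ n * φ θ / θ ^ (n + 1)) (𝓝[>] 0)
      (𝓝 ((q * β + c) / (n + 1))) := by
    refine HasDerivAt.lhopital_zero_nhdsGT
      (f' := fun θ => (n * θ ^ (n - 1)) * φ θ + θ ^ n * angleSlope q c n β θ (φ θ))
      (g' := fun θ => ((n + 1 : ℕ) : ℝ) * θ ^ n) ?_ ?_ ?_ ?_ ?_ ?_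
    · filter_upwards [eventually_mem_Ioo] with θ hθ
      exact (hasDerivAt_pow n θ).mul (h.deriv θ (Ioo_subset_Ioc_self hθ))
    · filter_upwards with θ
      simpa using hasDerivAt_pow (n + 1) θ
    · filter_upwards [eventually_mem_Ioo] with θ hθ
      have := hθ.1
      positivity
    · simpa using (hid.pow n).mul h.tendsto_zero
    · simpa using hid.pow (n + 1)
    · refine (h.tendsto_slope_add.div_const ((n : ℝ) + 1)).congr' ?_
      filter_upwards [eventually_mem_Ioo] with θ hθ
      have h0 := hθ.1.ne'
      rcases n with _ | m
      · simp
      · simp only [Nat.add_sub_cancel]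
        push_cast
        have : (m : ℝ) + 1 + 1 ≠ 0 := by positivity
        field_simp
        ring
  refine key.congr' ?_
  filter_upwards [eventually_mem_Ioo] with θ hθ
  have h0 := hθ.1.ne'
  field_simp
  ring

theorem tendsto_slope (h : IsPhase q c n β C φ) :
    Tendsto (fun θ => angleSlope q c n β θ (φ θ)) (𝓝[>] 0) (𝓝 ((q * β + c) / (n + 1))) := by
  have hn : (n : ℝ) + 1 ≠ 0 := by positivity
  have h1 := h.tendsto_slope_add.sub (h.tendsto_div.const_mul (n : ℝ))
  have e : q * β + c - n * ((q * β + c) / (n + 1)) = (q * β + c) / (n + 1) := by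
    field_simp; ring
  rw [e] at h1
  refine h1.congr fun θ => by ring

theorem tendsto_amplitudeSlope (h : IsPhase q c n β C φ) :
    Tendsto (fun θ => amplitudeSlope q c n β θ (φ θ)) (𝓝[>] 0) (𝓝 0) := by
  have hcos : Tendsto (fun θ => Real.cos (φ θ)) (𝓝[>] 0) (𝓝 1) := by
    simpa [Function.comp_def] using (Real.continuous_cos.tendsto 0).comp h.tendsto_zero
  have hsin : Tendsto (fun θ => Real.sin (φ θ)) (𝓝[>] 0) (𝓝 0) := by
    simpa [Function.comp_def] using (Real.continuous_sin.tendsto 0).comp h.tendsto_zero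
  have h1 := (hsin.mul ((hcos.const_mul ((q - 1) * β + c)).sub
    ((h.tendsto_div.mul h.tendsto_sinc_ratio).const_mul (n : ℝ)))).div h.tendsto_denom one_ne_zero
  rw [zero_mul, zero_div] at h1
  refine h1.congr' ?_
  filter_upwards [eventually_mem_Ioo] with θ hθ
  simp only [Pi.div_apply]
  rw [← h.cot_mul_sin hθ, amplitudeSlope, mul_assoc (n : ℝ)]

theorem continuousAt (h : IsPhase q c n β C φ) {θ : ℝ} (hθ : θ ∈ Ioc 0 (Real.pi / 2)) :
    ContinuousAt φ θ := (h.deriv θ hθ).continuousAt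

theorem continuousOn_of_tendsto {g : ℝ → ℝ} (h0 : Tendsto g (𝓝[>] 0) (𝓝 (g 0)))
    (h : ∀ θ ∈ Ioc 0 (Real.pi / 2), ContinuousAt g θ) : ContinuousOn g (Icc 0 (Real.pi / 2)) := by
  intro θ hθ
  rcases hθ.1.eq_or_lt with rfl | h1
  · refine (continuousWithinAt_Ioi_iff_Ici.1 (show ContinuousWithinAt g (Ioi 0) 0 from h0)).mono ?_
    exact Icc_subset_Ici_self
  · exact (h θ ⟨h1, hθ.2⟩).continuousWithinAt

theorem exists_profile (h : IsPhase q c n β C φ) (hq : 0 < q) (hβ : 0 < β) :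
    ∃ f f₁ f₂ : ℝ → ℝ, IsAngularSolution q c n β f f₁ f₂ ∧
      (∀ θ ∈ Ico 0 (Real.pi / 2), 0 < f θ) ∧ (∀ θ ∈ Ioc 0 (Real.pi / 2), f₁ θ < 0) ∧
      f (Real.pi / 2) = 0 := by
  have hpi := Real.pi_pos
  have hsinθ : ∀ θ ∈ Ioc 0 (Real.pi / 2), Real.sin θ ≠ 0 := fun θ hθ =>
    (Real.sin_pos_of_pos_of_lt_pi hθ.1 (by linarith [hθ.2])).ne'
  -- the phase is `C¹`
  set φ₁ : ℝ → ℝ := fun θ => if θ = 0 then (q * β + c) / (n + 1) else angleSlope q c n β θ (φ θ)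
    with hφ₁
  have hφ₁pos : ∀ θ ∈ Ioc 0 (Real.pi / 2), φ₁ θ = angleSlope q c n β θ (φ θ) := fun θ hθ =>
    if_neg hθ.1.ne'
  have hφcont : ContinuousOn φ (Icc 0 (Real.pi / 2)) :=
    continuousOn_of_tendsto (by rw [h.zero]; exact h.tendsto_zero) fun θ hθ => h.continuousAt hθ
  have hne : ∀ θ : ℝ, 0 < θ → ∀ᶠ s in 𝓝 θ, s ≠ 0 := fun θ hθ => by
    filter_upwards [Ioi_mem_nhds hθ] with s hs using hs.ne'
  have hφ₁cont : ContinuousOn φ₁ (Icc 0 (Real.pi / 2)) := by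
    refine continuousOn_of_tendsto ?_ fun θ hθ => ?_
    · have : φ₁ 0 = (q * β + c) / (n + 1) := if_pos rfl
      rw [this]
      refine h.tendsto_slope.congr' ?_
      filter_upwards [self_mem_nhdsWithin] with θ hθ
      exact (if_neg hθ.ne').symm
    · have h1 : ContinuousAt (fun θ => angleSlope q c n β θ (φ θ)) θ := by
        have h2 := h.continuousAt hθ
        unfold angleSlope
        have h3 := (cos_sq_add_pos hq (φ θ)).ne'
        have h4 := hsinθ θ hθ
        fun_prop (disch := assumption)
      refine h1.congr ?_
      filter_upwards [hne θ hθ.1] with s hs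
      exact (if_neg hs).symm
  have hφderiv : ∀ θ ∈ Icc 0 (Real.pi / 2),
      HasDerivWithinAt φ (φ₁ θ) (Icc 0 (Real.pi / 2)) θ := by
    intro θ hθ
    rcases hθ.1.eq_or_lt with rfl | h1
    · have h0 : φ₁ 0 = (q * β + c) / (n + 1) := if_pos rfl
      rw [h0]
      refine (hasDerivWithinAt_Ici_of_tendsto_deriv (s := Ioo 0 (Real.pi / 2)) ?_ ?_ ?_ ?_).mono
        Icc_subset_Ici_self
      · exact fun s hs =>
          (h.deriv s (Ioo_subset_Ioc_self hs)).differentiableAt.differentiableWithinAt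
      · exact (hφcont 0 hθ).mono Ioo_subset_Icc_self
      · exact Ioo_mem_nhdsGT (by positivity)
      · refine h.tendsto_slope.congr' ?_
        filter_upwards [eventually_mem_Ioo] with s hs
        exact (h.deriv s (Ioo_subset_Ioc_self hs)).deriv.symm
    · rw [hφ₁pos θ ⟨h1, hθ.2⟩]
      exact (h.deriv θ ⟨h1, hθ.2⟩).hasDerivWithinAt
  -- the amplitude
  set H : ℝ → ℝ := fun θ => amplitudeSlope q c n β θ (φ θ) with hH
  have hH0 : H 0 = 0 := by simp [hH, amplitudeSlope, h.zero]
  have hHcont : ContinuousOn H (Icc 0 (Real.pi / 2)) := by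
    refine continuousOn_of_tendsto (by rw [hH0]; exact h.tendsto_amplitudeSlope) fun θ hθ => ?_
    have h2 := h.continuousAt hθ
    simp only [hH, amplitudeSlope]
    have h3 := (cos_sq_add_pos hq (φ θ)).ne'
    have h4 := hsinθ θ hθ
    fun_prop (disch := assumption)
  -- Extending `H` continuously to the line makes its primitive differentiable at the end points
  -- too.
  set Hx : ℝ → ℝ := IccExtend (show (0 : ℝ) ≤ Real.pi / 2 by positivity)
    ((Icc 0 (Real.pi / 2)).domRestrict H) with hHx
  have hHxcont : Continuous Hx := (continuousOn_iff_continuous_domRestrict.1 hHcont).Icc_extend'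
  have hHxeq : ∀ θ ∈ Icc 0 (Real.pi / 2), Hx θ = H θ := fun θ hθ => IccExtend_of_mem _ _ hθ
  set E : ℝ → ℝ := fun θ => Real.exp (∫ s in (0 : ℝ)..θ, Hx s) with hE
  have hEpos : ∀ θ, 0 < E θ := fun θ => Real.exp_pos _
  have hEderiv : ∀ θ ∈ Icc 0 (Real.pi / 2),
      HasDerivWithinAt E (H θ * E θ) (Icc 0 (Real.pi / 2)) θ := by
    intro θ hθ
    have h1 := (hHxcont.integral_hasStrictDerivAt 0 θ).hasDerivAt.exp
    rw [hHxeq θ hθ, mul_comm] at h1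
    exact h1.hasDerivWithinAt
  have hEcont : ContinuousOn E (Icc 0 (Real.pi / 2)) := fun θ hθ =>
    (hEderiv θ hθ).continuousWithinAt
  -- This compatibility says that `(cos φ * E)' = -β sin φ * E`; the two slopes are the solution of
  -- the linear system formed by it and the angular equation.
  have hrel : ∀ θ ∈ Icc 0 (Real.pi / 2),
      Real.sin (φ θ) * (φ₁ θ - β) = Real.cos (φ θ) * H θ := by
    intro θ hθ
    rcases hθ.1.eq_or_lt with rfl | h1
    · rw [h.zero, hH0]; simp
    · rw [hφ₁pos θ ⟨h1, hθ.2⟩]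
      have h3 := (cos_sq_add_pos hq (φ θ)).ne'
      have e1 := angleSlope_mul hq c n β θ (φ θ)
      have e2 := amplitudeSlope_mul hq c n β θ (φ θ)
      have h4 : Real.cos (φ θ) ^ 2 = 1 - Real.sin (φ θ) ^ 2 := Real.cos_sq' _
      apply mul_right_cancel₀ h3
      linear_combination Real.sin (φ θ) * e1 - Real.cos (φ θ) * e2 -
        q * β * Real.sin (φ θ) * h4
  refine ⟨fun θ => Real.cos (φ θ) * E θ, fun θ => -β * (Real.sin (φ θ) * E θ),
    fun θ => -β * ((Real.cos (φ θ) * φ₁ θ + Real.sin (φ θ) * H θ) * E θ),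
    ⟨fun θ hθ => ?_, fun θ hθ => ?_, ?_, fun θ hθ => ?_, ?_, ?_⟩, fun θ hθ => ?_, fun θ hθ => ?_, ?_⟩
  · have := (hφderiv θ hθ).cos.mul (hEderiv θ hθ)
    refine this.congr_deriv ?_
    linear_combination -E θ * hrel θ hθ
  · have := ((hφderiv θ hθ).sin.mul (hEderiv θ hθ)).const_mul (-β)
    refine this.congr_deriv ?_
    ring
  · fun_prop
  · have hθ' := Ioo_subset_Ioc_self hθ
    simp only [hφ₁pos θ hθ']
    have e1 := angleSlope_mul hq c n β θ (φ θ)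
    have e2 : H θ * _ = _ := amplitudeSlope_mul hq c n β θ (φ θ)
    have h4 : Real.cos (φ θ) ^ 2 = 1 - Real.sin (φ θ) ^ 2 := Real.cos_sq' _
    -- The quadratic forms of `angularOp` reduce to `ρ²` and `ρ²` times the common denominator of
    -- the slopes, with `ρ = β E`.
    have hA : β ^ 2 * (Real.cos (φ θ) * E θ) ^ 2 + (-β * (Real.sin (φ θ) * E θ)) ^ 2 =
        β ^ 2 * E θ ^ 2 := by rw [mul_pow, h4]; ring
    have hD : β ^ 2 * E θ ^ 2 + (q - 1) * (-β * (Real.sin (φ θ) * E θ)) ^ 2 =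
        β ^ 2 * E θ ^ 2 * (Real.cos (φ θ) ^ 2 + q * Real.sin (φ θ) ^ 2) := by rw [h4]; ring
    rw [angularOp, hA, hD]
    linear_combination -β ^ 3 * E θ ^ 3 * (Real.cos (φ θ) * e1 + Real.sin (φ θ) * e2) +
      β ^ 3 * E θ ^ 3 *
        (n * (Real.cos θ / Real.sin θ) * Real.sin (φ θ) - c * Real.cos (φ θ)) * h4
  · simp [h.zero, hE]
  · simp [h.zero]
  · refine mul_pos ?_ (hEpos θ)
    rcases hθ.1.eq_or_lt with rfl | h1
    · simp [h.zero]
    · exact Real.cos_pos_of_mem_Ioo ⟨by linarith [h.pos θ ⟨h1, hθ.2⟩], h.lt θ ⟨h1, hθ.2⟩⟩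
  · have : 0 < Real.sin (φ θ) := by
      rcases hθ.2.eq_or_lt with rfl | h1
      · simp [h.pi_div_two]
      · exact Real.sin_pos_of_pos_of_lt_pi (h.pos θ ⟨hθ.1, h1⟩) (by linarith [h.lt θ ⟨hθ.1, h1⟩])
    have := mul_pos hβ (mul_pos this (hEpos θ))
    linarith
  · simp [h.pi_div_two]

end IsPhase

/-! ### Integration by parts for fields spanned by position and a fixed vector -/

section IntegrationByParts

variable {F : Type*} [NormedAddCommGroup F] [InnerProductSpace ℝ F] [FiniteDimensional ℝ F]
  [MeasurableSpace F] [BorelSpace F]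

theorem integrable_mul_of_tsupport {w ψ : F → ℝ} (hw : ContinuousOn w (tsupport ψ))
    (hψ : Continuous ψ) (hc : HasCompactSupport ψ) : Integrable fun x => w x * ψ x := by
  have h1 : IntegrableOn (fun x => w x * ψ x) (tsupport ψ) :=
    (hw.mul hψ.continuousOn).integrableOn_compact hc.isCompact
  refine (integrableOn_iff_integrable_of_support_subset fun x hx => ?_).1 h1
  exact subset_tsupport ψ fun h => hx (by simp [h])

/-- Integration by parts against a test function supported in the open set where `w` is `C¹`. -/
theorem integral_mul_fderiv_of_tsupport_subset {U : Set F} (hU : IsOpen U) {w φ : F → ℝ}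
    (hw : ContDiffOn ℝ 1 w U) (hφ : ContDiff ℝ 1 φ) (hc : HasCompactSupport φ)
    (hsub : tsupport φ ⊆ U) (v : F) :
    (Integrable fun x => w x * fderiv ℝ φ x v) ∧ (Integrable fun x => φ x * fderiv ℝ w x v) ∧
    ∫ x, w x * fderiv ℝ φ x v = -∫ x, φ x * fderiv ℝ w x v := by
  have hcw : ContinuousOn w U := hw.continuousOn
  have hdw : ContinuousOn (fun x => fderiv ℝ w x v) U :=
    (hw.continuousOn_fderiv_of_isOpen hU le_rfl).clm_apply continuousOn_const
  have hdφ : Continuous fun x => fderiv ℝ φ x v :=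
    (hφ.continuous_fderiv one_ne_zero).clm_apply continuous_const
  have hts : tsupport (fun x => fderiv ℝ φ x v) ⊆ tsupport φ := by
    refine closure_minimal (fun x hx => ?_) (isClosed_tsupport φ)
    exact support_fderiv_subset ℝ (fun h => hx (by simp [h]))
  have hdc : HasCompactSupport fun x => fderiv ℝ φ x v := hc.fderiv_apply ℝ v
  have i1 : Integrable fun x => w x * fderiv ℝ φ x v :=
    integrable_mul_of_tsupport (hcw.mono (hts.trans hsub)) hdφ hdc
  have i2 : Integrable fun x => fderiv ℝ w x v * φ x :=
    integrable_mul_of_tsupport (hdw.mono hsub) hφ.continuous hc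
  have i3 : Integrable fun x => w x * φ x :=
    integrable_mul_of_tsupport (hcw.mono hsub) hφ.continuous hc
  refine ⟨i1, by simpa only [mul_comm] using i2, ?_⟩
  rw [integral_mul_fderiv_eq_neg_fderiv_mul_of_integrable i2 i1 i3
    (fun x hx => (hw.differentiableOn one_ne_zero).differentiableAt (hU.mem_nhds (hsub hx)))
    (fun x _ => hφ.differentiable one_ne_zero x)]
  simp only [mul_comm]

/-- Integration by parts for the vector field `a(x) x + b(x) e`. -/
theorem integral_field_eq_neg_integral_div {U : Set F} (hU : IsOpen U) {a b φ : F → ℝ}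
    (ha : ContDiffOn ℝ 1 a U) (hb : ContDiffOn ℝ 1 b U) (hφ : ContDiff ℝ 1 φ)
    (hc : HasCompactSupport φ) (hsub : tsupport φ ⊆ U) (e : F) :
    ∫ x, (a x * fderiv ℝ φ x x + b x * fderiv ℝ φ x e) =
      -∫ x, φ x * (Module.finrank ℝ F * a x + fderiv ℝ a x x + fderiv ℝ b x e) := by
  -- In this basis the field `a(x) x` has components `a(x) ⟨B i, x⟩`; differentiating the second
  -- factors and summing produces `finrank * a`.
  set B := stdOrthonormalBasis ℝ F
  have hexp : ∀ (L : F →L[ℝ] ℝ) (x : F), L x = ∑ i, inner ℝ (B i) x * L (B i) := by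
    intro L x
    conv_lhs => rw [← B.sum_repr' x]
    simp [map_sum]
  have hw : ∀ i, ContDiffOn ℝ 1 (fun x => a x * inner ℝ (B i) x) U := fun i =>
    ha.mul (contDiff_const.inner ℝ contDiff_id).contDiffOn
  have hib := fun i => integral_mul_fderiv_of_tsupport_subset hU (hw i) hφ hc hsub (B i)
  obtain ⟨j1, j2, j3⟩ := integral_mul_fderiv_of_tsupport_subset hU hb hφ hc hsub e
  have e1 : ∀ x, a x * fderiv ℝ φ x x + b x * fderiv ℝ φ x e =
      ∑ i, a x * inner ℝ (B i) x * fderiv ℝ φ x (B i) + b x * fderiv ℝ φ x e := by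
    intro x
    rw [hexp (fderiv ℝ φ x) x, Finset.mul_sum]
    simp only [mul_assoc]
  have e2 : ∀ x, φ x * (Module.finrank ℝ F * a x + fderiv ℝ a x x + fderiv ℝ b x e) =
      ∑ i, φ x * fderiv ℝ (fun x => a x * inner ℝ (B i) x) x (B i) + φ x * fderiv ℝ b x e := by
    intro x
    by_cases hx : x ∈ tsupport φ
    · have hd : DifferentiableAt ℝ a x :=
        (ha.differentiableOn one_ne_zero).differentiableAt (hU.mem_nhds (hsub hx))
      have hi : ∀ i, fderiv ℝ (fun x => a x * inner ℝ (B i) x) x (B i) =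
          a x + inner ℝ (B i) x * fderiv ℝ a x (B i) := by
        intro i
        have h1 : HasFDerivAt (fun x => inner ℝ (B i) x) (innerSL ℝ (B i)) x :=
          (innerSL ℝ (B i)).hasFDerivAt
        have h2 : fderiv ℝ (fun x => a x * inner ℝ (B i) x) x = _ := (hd.hasFDerivAt.mul h1).fderiv
        rw [h2]
        simp
      simp only [hi]
      rw [← Finset.mul_sum, Finset.sum_add_distrib, ← hexp]
      simp
      ring
    · simp [image_eq_zero_of_notMem_tsupport hx]
  simp only [e1, e2]
  rw [integral_add (integrable_finsetSum _ fun i _ => (hib i).1) j1,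
    integral_add (integrable_finsetSum _ fun i _ => (hib i).2.1) j2,
    integral_finsetSum _ fun i _ => (hib i).1, integral_finsetSum _ fun i _ => (hib i).2.1, j3,
    Finset.sum_congr rfl fun i _ => (hib i).2.2, Finset.sum_neg_distrib]
  ring

end IntegrationByParts

/-! ### Homogeneous axially symmetric functions and their gradients -/

section Homogeneous

variable {F : Type*} [NormedAddCommGroup F] [InnerProductSpace ℝ F]

/-- The cosine of the angle between `x` and the unit vector `e`. -/
noncomputable def cosTo (e x : F) : ℝ := inner ℝ e x / ‖x‖

theorem cosTo_le_one {e : F} (he : ‖e‖ = 1) (x : F) : cosTo e x ≤ 1 := by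
  refine div_le_one_of_le₀ ?_ (norm_nonneg x)
  simpa [he] using real_inner_le_norm e x

theorem inner_eq_cosTo_mul (e x : F) : inner ℝ e x = cosTo e x * ‖x‖ := by
  rcases eq_or_ne x 0 with rfl | hx
  · simp
  · rw [cosTo, div_mul_cancel₀ _ (norm_ne_zero_iff.2 hx)]

theorem hasFDerivAt_norm_rpow_of_ne_zero {x : F} (hx : x ≠ 0) (s : ℝ) :
    HasFDerivAt (fun x : F => ‖x‖ ^ s) ((s * ‖x‖ ^ (s - 2)) • innerSL ℝ x) x := by
  have h0 : 0 < ‖x‖ := norm_pos_iff.2 hx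
  have h1 := ((hasStrictFDerivAt_norm_sq x).hasFDerivAt).rpow_const (p := s / 2)
    (Or.inl (by positivity))
  have e1 : (fun x : F => ‖x‖ ^ s) = fun x : F => (‖x‖ ^ 2) ^ (s / 2) := by
    ext y
    rw [← Real.rpow_natCast, ← Real.rpow_mul (norm_nonneg y)]
    congr 1; push_cast; ring
  rw [e1]
  refine h1.congr_fderiv ?_
  have e2 : (‖x‖ ^ 2) ^ (s / 2 - 1) = ‖x‖ ^ (s - 2) := by
    rw [← Real.rpow_natCast, ← Real.rpow_mul h0.le]
    congr 1; push_cast; ring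
  rw [e2]
  ext v
  simp
  ring

theorem hasFDerivAt_cosTo (e : F) {x : F} (hx : x ≠ 0) :
    HasFDerivAt (cosTo e)
      (‖x‖⁻¹ • innerSL ℝ e - (cosTo e x * (‖x‖ ^ 2)⁻¹) • innerSL ℝ x) x := by
  have h0 : 0 < ‖x‖ := norm_pos_iff.2 hx
  have h1 := ((innerSL ℝ e).hasFDerivAt (x := x)).mul (hasFDerivAt_norm_rpow_of_ne_zero hx (-1))
  have e1 : cosTo e = fun x => innerSL ℝ e x * ‖x‖ ^ (-1 : ℝ) := by
    ext y; rw [Real.rpow_neg_one, cosTo, div_eq_mul_inv]; rfl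
  have e2 : ‖x‖ ^ ((-1 : ℝ) - 2) = (‖x‖ ^ 3)⁻¹ := by
    rw [show (-1 : ℝ) - 2 = -((3 : ℕ) : ℝ) by norm_num, Real.rpow_neg h0.le, Real.rpow_natCast]
  conv in cosTo e => rw [e1]
  refine h1.congr_fderiv ?_
  ext v
  rw [e2, Real.rpow_neg_one]
  simp [inner_eq_cosTo_mul e x]
  field_simp
  ring

/-- The gradient of `|x|^s P(t)`, where `t` is the cosine of the angle with `e`. -/
noncomputable def homogeneousGrad (e : F) (s : ℝ) (P P₁ : ℝ → ℝ) (x : F) : F :=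
  (‖x‖ ^ (s - 2) * (s * P (cosTo e x) - cosTo e x * P₁ (cosTo e x))) • x +
    (‖x‖ ^ (s - 1) * P₁ (cosTo e x)) • e

/-- A one-sided derivative of `P` suffices because `cosTo e` never exceeds `1`; this covers points
of the axis, where `t = 1`. -/
theorem hasFDerivAt_homogeneous {e : F} (he : ‖e‖ = 1) {x : F} (hx : x ≠ 0) (s : ℝ) {P P₁ : ℝ → ℝ}
    (hP : HasDerivWithinAt P (P₁ (cosTo e x)) (Iic 1) (cosTo e x)) :
    HasFDerivAt (fun x => ‖x‖ ^ s * P (cosTo e x)) (innerSL ℝ (homogeneousGrad e s P P₁ x)) x := by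
  have h0 : 0 < ‖x‖ := norm_pos_iff.2 hx
  have h1 := (hasFDerivAt_norm_rpow_of_ne_zero hx s).mul
    (hP.comp_hasFDerivAt x (hasFDerivAt_cosTo e hx) (Eventually.of_forall fun y => cosTo_le_one he y))
  refine h1.congr_fderiv ?_
  have e1 : ‖x‖ ^ s = ‖x‖ ^ (s - 2) * ‖x‖ ^ 2 := by
    rw [← Real.rpow_natCast, ← Real.rpow_add h0]; congr 1; push_cast; ring
  have e2 : ‖x‖ ^ (s - 1) = ‖x‖ ^ (s - 2) * ‖x‖ := by
    conv_rhs => rw [← Real.rpow_one ‖x‖, ← Real.rpow_mul h0.le, ← Real.rpow_add h0]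
    congr 1; ring
  ext v
  simp only [homogeneousGrad, e1, e2]
  simp
  field_simp
  ring

theorem inner_homogeneousGrad_self (e : F) {x : F} (hx : x ≠ 0) (s : ℝ) (P P₁ : ℝ → ℝ) :
    inner ℝ (homogeneousGrad e s P P₁ x) x = s * (‖x‖ ^ s * P (cosTo e x)) := by
  have h0 : 0 < ‖x‖ := norm_pos_iff.2 hx
  have e1 : ‖x‖ ^ s = ‖x‖ ^ (s - 2) * ‖x‖ ^ 2 := by
    rw [← Real.rpow_natCast, ← Real.rpow_add h0]; congr 1; push_cast; ring
  have e2 : ‖x‖ ^ (s - 1) = ‖x‖ ^ (s - 2) * ‖x‖ := by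
    conv_rhs => rw [← Real.rpow_one ‖x‖, ← Real.rpow_mul h0.le, ← Real.rpow_add h0]
    congr 1; ring
  rw [homogeneousGrad, inner_add_left, inner_smul_left, inner_smul_left,
    real_inner_self_eq_norm_sq, inner_eq_cosTo_mul e x, e1, e2]
  simp only [conj_trivial]
  ring

theorem inner_homogeneousGrad_axis {e : F} (he : ‖e‖ = 1) {x : F} (hx : x ≠ 0) (s : ℝ)
    (P P₁ : ℝ → ℝ) :
    inner ℝ (homogeneousGrad e s P P₁ x) e = ‖x‖ ^ (s - 1) *
      (s * cosTo e x * P (cosTo e x) + (1 - cosTo e x ^ 2) * P₁ (cosTo e x)) := by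
  have h0 : 0 < ‖x‖ := norm_pos_iff.2 hx
  have e2 : ‖x‖ ^ (s - 1) = ‖x‖ ^ (s - 2) * ‖x‖ := by
    conv_rhs => rw [← Real.rpow_one ‖x‖, ← Real.rpow_mul h0.le, ← Real.rpow_add h0]
    congr 1; ring
  rw [homogeneousGrad, inner_add_left, inner_smul_left, inner_smul_left,
    real_inner_self_eq_norm_sq, real_inner_comm, inner_eq_cosTo_mul e x, he, e2]
  simp only [conj_trivial]
  ring

theorem norm_homogeneousGrad_sq {e : F} (he : ‖e‖ = 1) {x : F} (hx : x ≠ 0) (s : ℝ)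
    (P P₁ : ℝ → ℝ) :
    ‖homogeneousGrad e s P P₁ x‖ ^ 2 = (‖x‖ ^ (s - 1)) ^ 2 *
      (s ^ 2 * P (cosTo e x) ^ 2 + (1 - cosTo e x ^ 2) * P₁ (cosTo e x) ^ 2) := by
  have h0 : 0 < ‖x‖ := norm_pos_iff.2 hx
  have e1 : ‖x‖ ^ s = ‖x‖ ^ (s - 1) * ‖x‖ := by
    conv_rhs => rw [← Real.rpow_one ‖x‖, ← Real.rpow_mul h0.le, ← Real.rpow_add h0]
    congr 1; ring
  have e2 : ‖x‖ ^ (s - 1) = ‖x‖ ^ (s - 2) * ‖x‖ := by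
    conv_rhs => rw [← Real.rpow_one ‖x‖, ← Real.rpow_mul h0.le, ← Real.rpow_add h0]
    congr 1; ring
  rw [← real_inner_self_eq_norm_sq]
  conv_lhs => arg 3; rw [homogeneousGrad]
  rw [inner_add_right, inner_smul_right, inner_smul_right, inner_homogeneousGrad_self e hx,
    inner_homogeneousGrad_axis he hx, e1, e2]
  ring

theorem contDiffOn_cosTo (e : F) {n : WithTop ℕ∞} : ContDiffOn ℝ n (cosTo e) {x | x ≠ 0} :=
  (contDiff_const.inner ℝ contDiff_id).contDiffOn.div
    (fun _ hx => (contDiffAt_norm ℝ hx).contDiffWithinAt) fun _ hx => norm_ne_zero_iff.2 hx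

theorem contDiffOn_norm_rpow (s : ℝ) {n : WithTop ℕ∞} :
    ContDiffOn ℝ n (fun x : F => ‖x‖ ^ s) {x | x ≠ 0} := fun _ hx =>
  ((contDiffAt_norm ℝ hx).contDiffWithinAt).rpow_const_of_ne (norm_ne_zero_iff.2 hx)

end Homogeneous

/-! ### Profile and flux in the variable `t = cos θ` -/

/-- The `t`-derivative of `f (arccos t)` on `(0, 1]`, for `f' = f₁`, `f'' = f₂`, `f₁ 0 = 0`. -/
noncomputable def cosProfileDeriv (f₁ f₂ : ℝ → ℝ) (t : ℝ) : ℝ :=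
  if t = 1 then -f₂ 0 else -f₁ (Real.arccos t) / √(1 - t ^ 2)

/-- The squared length of the gradient of `|x|^k h(t)` on the unit sphere. -/
noncomputable def speedSq (k : ℝ) (h h₁ : ℝ → ℝ) (t : ℝ) : ℝ :=
  k ^ 2 * h t ^ 2 + (1 - t ^ 2) * h₁ t ^ 2

/-- The axial component of the flux `|∇u|^(p-2) ∇u` of `u = |x|^k h(t)` on the unit sphere. -/
noncomputable def axialFlux (p k : ℝ) (h h₁ : ℝ → ℝ) (t : ℝ) : ℝ :=
  speedSq k h h₁ t ^ ((p - 2) / 2) * h₁ t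

/-- The radial component of the flux `|∇u|^(p-2) ∇u` of `u = |x|^k h(t)` on the unit sphere. -/
noncomputable def radialFlux (p k : ℝ) (h h₁ : ℝ → ℝ) (t : ℝ) : ℝ :=
  speedSq k h h₁ t ^ ((p - 2) / 2) * (k * h t - t * h₁ t)

theorem arccos_mem_Ioo {t : ℝ} (ht : t ∈ Ioo (0 : ℝ) 1) : Real.arccos t ∈ Ioo 0 (Real.pi / 2) :=
  ⟨Real.arccos_pos.2 ht.2, Real.arccos_lt_pi_div_two.2 ht.1⟩

section

variable {f f₁ f₂ : ℝ → ℝ} {p k : ℝ}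

theorem hasDerivAt_arccos_of_mem {t : ℝ} (ht : t ∈ Ioo (0 : ℝ) 1) :
    HasDerivAt Real.arccos (-(1 / √(1 - t ^ 2))) t :=
  Real.hasDerivAt_arccos (by linarith [ht.1]) ht.2.ne

theorem sqrt_one_sub_sq_pos {t : ℝ} (ht : t ∈ Ioo (0 : ℝ) 1) : 0 < √(1 - t ^ 2) :=
  Real.sqrt_pos.2 (by nlinarith [ht.1, ht.2])

theorem hasDerivAt_cosProfile (hf : ∀ θ ∈ Ioo 0 (Real.pi / 2), HasDerivAt f (f₁ θ) θ) {t : ℝ}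
    (ht : t ∈ Ioo (0 : ℝ) 1) :
    HasDerivAt (fun t => f (Real.arccos t)) (cosProfileDeriv f₁ f₂ t) t := by
  refine ((hf _ (arccos_mem_Ioo ht)).comp t (hasDerivAt_arccos_of_mem ht)).congr_deriv ?_
  rw [cosProfileDeriv, if_neg ht.2.ne]
  ring

theorem speedSq_cosProfile {t : ℝ} (ht : t ∈ Ioo (0 : ℝ) 1) :
    speedSq k (fun t => f (Real.arccos t)) (cosProfileDeriv f₁ f₂) t =
      k ^ 2 * f (Real.arccos t) ^ 2 + f₁ (Real.arccos t) ^ 2 := by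
  have h1 := sqrt_one_sub_sq_pos ht
  have h2 : √(1 - t ^ 2) ^ 2 = 1 - t ^ 2 := Real.sq_sqrt (by nlinarith [ht.1, ht.2])
  have h3 : 1 - t ^ 2 ≠ 0 := by rw [← h2]; positivity
  rw [speedSq, cosProfileDeriv, if_neg ht.2.ne, div_pow, h2, mul_div_cancel₀ _ h3, neg_sq]

theorem axialFlux_cosProfile {t : ℝ} (ht : t ∈ Ioo (0 : ℝ) 1) :
    axialFlux p k (fun t => f (Real.arccos t)) (cosProfileDeriv f₁ f₂) t =
      -((k ^ 2 * f (Real.arccos t) ^ 2 + f₁ (Real.arccos t) ^ 2) ^ ((p - 2) / 2) *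
        f₁ (Real.arccos t)) / √(1 - t ^ 2) := by
  rw [axialFlux, speedSq_cosProfile ht, cosProfileDeriv, if_neg ht.2.ne]
  ring

theorem radialFlux_cosProfile {t : ℝ} (ht : t ∈ Ioo (0 : ℝ) 1) :
    radialFlux p k (fun t => f (Real.arccos t)) (cosProfileDeriv f₁ f₂) t =
      (k ^ 2 * f (Real.arccos t) ^ 2 + f₁ (Real.arccos t) ^ 2) ^ ((p - 2) / 2) *
        (k * f (Real.arccos t) + t * (f₁ (Real.arccos t) / √(1 - t ^ 2))) := by
  rw [radialFlux, speedSq_cosProfile ht, cosProfileDeriv, if_neg ht.2.ne]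
  ring

/-- The divergence of the flux, expressed through the angular operator. -/
theorem exists_hasDerivAt_axialFlux (hf : ∀ θ ∈ Ioo 0 (Real.pi / 2), HasDerivAt f (f₁ θ) θ)
    (hf₁ : ∀ θ ∈ Ioo 0 (Real.pi / 2), HasDerivAt f₁ (f₂ θ) θ)
    (hpos : ∀ θ ∈ Ioo 0 (Real.pi / 2), 0 < f θ) (hk : k ≠ 0) (ν : ℝ) {t : ℝ}
    (ht : t ∈ Ioo (0 : ℝ) 1) :
    ∃ Q', HasDerivAt (axialFlux p k (fun t => f (Real.arccos t)) (cosProfileDeriv f₁ f₂)) Q' t ∧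
      ∃ w > 0, ((k - 1) * (p - 1) + ν - 1) *
          radialFlux p k (fun t => f (Real.arccos t)) (cosProfileDeriv f₁ f₂) t +
        (k - 1) * (p - 1) * t *
          axialFlux p k (fun t => f (Real.arccos t)) (cosProfileDeriv f₁ f₂) t +
        (1 - t ^ 2) * Q' = w * angularOp (p - 1) (p - ν) (ν - 2) (-k) (Real.arccos t)
          (f (Real.arccos t)) (f₁ (Real.arccos t)) (f₂ (Real.arccos t)) := by
  have hθ := arccos_mem_Ioo ht
  have hs := sqrt_one_sub_sq_pos ht
  have hs2 : √(1 - t ^ 2) ^ 2 = 1 - t ^ 2 := Real.sq_sqrt (by nlinarith [ht.1, ht.2])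
  have hA : ∀ θ ∈ Ioo 0 (Real.pi / 2), 0 < k ^ 2 * f θ ^ 2 + f₁ θ ^ 2 := fun θ hθ => by
    have := hpos θ hθ
    positivity
  have hAd := (((hf _ hθ).pow 2).const_mul (k ^ 2)).add ((hf₁ _ hθ).pow 2)
  have hB := (hAd.rpow_const (p := (p - 2) / 2) (Or.inl (hA _ hθ).ne')).mul (hf₁ _ hθ)
  have hsd : HasDerivAt (fun t : ℝ => √(1 - t ^ 2)) (-(2 * t) / (2 * √(1 - t ^ 2))) t := by
    have := ((hasDerivAt_pow 2 t).const_sub 1).sqrt (by rw [← hs2]; positivity)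
    simpa using this
  have hQ := ((hB.comp t (hasDerivAt_arccos_of_mem ht)).neg).div hsd hs.ne'
  have hQ' := hQ.congr_of_eventuallyEq
    (f₁ := axialFlux p k (fun t => f (Real.arccos t)) (cosProfileDeriv f₁ f₂)) (by
      filter_upwards [Ioo_mem_nhds ht.1 ht.2] with s hs
      rw [axialFlux_cosProfile hs]; rfl)
  -- The weight is `A^((p-2)/2) / A` with `A = k² f² + f'²`: `angularOp` is the divergence cleared
  -- of the power `A^((p-4)/2)`.
  refine ⟨_, hQ', (k ^ 2 * f (Real.arccos t) ^ 2 + f₁ (Real.arccos t) ^ 2) ^ ((p - 2) / 2) /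
    (k ^ 2 * f (Real.arccos t) ^ 2 + f₁ (Real.arccos t) ^ 2),
    div_pos (Real.rpow_pos_of_pos (hA _ hθ) _) (hA _ hθ), ?_⟩
  rw [axialFlux_cosProfile ht, radialFlux_cosProfile ht, angularOp, Real.sin_arccos,
    Real.cos_arccos (by linarith [ht.1]) ht.2.le]
  have hA0 := (hA _ hθ)
  simp only [Pi.add_apply, Pi.mul_apply, Pi.neg_apply, Function.comp_apply, Pi.pow_apply]
  rw [Real.rpow_sub_one hA0.ne']
  set s := √(1 - t ^ 2)
  rw [← hs2]
  generalize f (Real.arccos t) = y at *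
  generalize f₁ (Real.arccos t) = y₁ at *
  generalize f₂ (Real.arccos t) = y₂ at *
  generalize hW : (k ^ 2 * y ^ 2 + y₁ ^ 2) ^ ((p - 2) / 2) = W at *
  clear hQ hQ' hsd hB hAd hW
  rw [neg_sq]
  push_cast
  field_simp
  ring

theorem contDiffOn_flux (hf : ContDiffOn ℝ 1 f (Ioo 0 (Real.pi / 2)))
    (hf₁ : ContDiffOn ℝ 1 f₁ (Ioo 0 (Real.pi / 2)))
    (hpos : ∀ θ ∈ Ioo 0 (Real.pi / 2), 0 < f θ) (hk : k ≠ 0) :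
    ContDiffOn ℝ 1 (axialFlux p k (fun t => f (Real.arccos t)) (cosProfileDeriv f₁ f₂))
      (Ioo 0 1) ∧
    ContDiffOn ℝ 1 (radialFlux p k (fun t => f (Real.arccos t)) (cosProfileDeriv f₁ f₂))
      (Ioo 0 1) := by
  have hac : ContDiffOn ℝ 1 Real.arccos (Ioo 0 1) := fun t ht =>
    (Real.contDiffAt_arccos (by linarith [ht.1]) ht.2.ne).contDiffWithinAt
  have hs : ContDiffOn ℝ 1 (fun t : ℝ => √(1 - t ^ 2)) (Ioo 0 1) :=
    (contDiff_const.sub (contDiff_id.pow 2)).contDiffOn.sqrt fun t ht =>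
      (Real.sqrt_pos.1 (sqrt_one_sub_sq_pos ht)).ne'
  have h1 : ContDiffOn ℝ 1 (fun t => f (Real.arccos t)) (Ioo 0 1) :=
    hf.comp hac fun t ht => arccos_mem_Ioo ht
  have h2 : ContDiffOn ℝ 1 (fun t => f₁ (Real.arccos t)) (Ioo 0 1) :=
    hf₁.comp hac fun t ht => arccos_mem_Ioo ht
  have hW : ContDiffOn ℝ 1 (fun t => (k ^ 2 * f (Real.arccos t) ^ 2 + f₁ (Real.arccos t) ^ 2) ^
      ((p - 2) / 2)) (Ioo 0 1) :=
    ((contDiffOn_const.mul (h1.pow 2)).add (h2.pow 2)).rpow_const_of_ne fun t ht => by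
      have := hpos _ (arccos_mem_Ioo ht)
      positivity
  refine ⟨((hW.mul h2).neg.div hs fun t ht => (sqrt_one_sub_sq_pos ht).ne').congr fun t ht =>
      axialFlux_cosProfile ht,
    (hW.mul ((contDiffOn_const.mul h1).add (contDiff_id.contDiffOn.mul
      (h2.div hs fun t ht => (sqrt_one_sub_sq_pos ht).ne')))).congr fun t ht =>
      radialFlux_cosProfile ht⟩

end

/-! ### The flux field and its divergence -/

section Field

variable {F : Type*} [NormedAddCommGroup F] [InnerProductSpace ℝ F] {e : F}

/-- The flux `|∇u|^(p-2) ∇u` of `u = |x|^k h(t)`. -/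
theorem flux_homogeneousGrad (he : ‖e‖ = 1) {x : F} (hx : x ≠ 0) (p k : ℝ) {h h₁ : ℝ → ℝ}
    (hA : 0 < speedSq k h h₁ (cosTo e x)) :
    ‖homogeneousGrad e k h h₁ x‖ ^ (p - 2) • homogeneousGrad e k h h₁ x =
      (‖x‖ ^ ((k - 1) * (p - 1) - 1) * radialFlux p k h h₁ (cosTo e x)) • x +
        (‖x‖ ^ ((k - 1) * (p - 1)) * axialFlux p k h h₁ (cosTo e x)) • e := by
  have h0 : 0 < ‖x‖ := norm_pos_iff.2 hx
  have h1 := norm_homogeneousGrad_sq he hx k h h₁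
  have h2 : ‖homogeneousGrad e k h h₁ x‖ ^ (p - 2) =
      ‖x‖ ^ ((k - 1) * (p - 2)) * speedSq k h h₁ (cosTo e x) ^ ((p - 2) / 2) := by
    have e1 : ‖homogeneousGrad e k h h₁ x‖ ^ (p - 2) =
        (‖homogeneousGrad e k h h₁ x‖ ^ 2) ^ ((p - 2) / 2) := by
      rw [← Real.rpow_natCast, ← Real.rpow_mul (norm_nonneg _)]
      congr 1; push_cast; ring
    rw [e1, h1]
    rw [show k ^ 2 * h (cosTo e x) ^ 2 + (1 - cosTo e x ^ 2) * h₁ (cosTo e x) ^ 2 =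
      speedSq k h h₁ (cosTo e x) from rfl, Real.mul_rpow (by positivity) hA.le]
    congr 1
    rw [← Real.rpow_natCast, ← Real.rpow_mul h0.le, ← Real.rpow_mul h0.le]
    congr 1; push_cast; ring
  rw [h2, homogeneousGrad, smul_add, smul_smul, smul_smul, radialFlux, axialFlux]
  have e1 : ‖x‖ ^ ((k - 1) * (p - 1) - 1) = ‖x‖ ^ ((k - 1) * (p - 2)) * ‖x‖ ^ (k - 2) := by
    rw [← Real.rpow_add h0]; congr 1; ring
  have e2 : ‖x‖ ^ ((k - 1) * (p - 1)) = ‖x‖ ^ ((k - 1) * (p - 2)) * ‖x‖ ^ (k - 1) := by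
    rw [← Real.rpow_add h0]; congr 1; ring
  rw [e1, e2]
  congr 2 <;> ring

/-- The open half-space in direction `e`. -/
def halfSpace (e : F) : Set F := {x | 0 < inner ℝ e x}

/-- The half-space without its axis. -/
def offAxis (e : F) : Set F := {x | 0 < inner ℝ e x ∧ inner ℝ e x < ‖x‖}

theorem isOpen_halfSpace (e : F) : IsOpen (halfSpace e) :=
  isOpen_lt continuous_const (by fun_prop)

theorem isOpen_offAxis (e : F) : IsOpen (offAxis e) :=
  (isOpen_halfSpace e).inter
    (isOpen_lt (f := fun x => inner ℝ e x) (by fun_prop) continuous_norm)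

theorem offAxis_subset (e : F) : offAxis e ⊆ halfSpace e := fun _ hx => hx.1

theorem ne_zero_of_mem_halfSpace {x : F} (hx : x ∈ halfSpace e) : x ≠ 0 := by
  rintro rfl; simp [halfSpace] at hx

theorem cosTo_mem_Ioc (he : ‖e‖ = 1) {x : F} (hx : x ∈ halfSpace e) : cosTo e x ∈ Ioc (0 : ℝ) 1 :=
  ⟨div_pos hx (norm_pos_iff.2 (ne_zero_of_mem_halfSpace hx)), cosTo_le_one he x⟩

theorem cosTo_mem_Ioo {x : F} (hx : x ∈ offAxis e) : cosTo e x ∈ Ioo (0 : ℝ) 1 := by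
  have h0 := norm_pos_iff.2 (ne_zero_of_mem_halfSpace (offAxis_subset e hx))
  exact ⟨div_pos hx.1 h0, (div_lt_one h0).2 hx.2⟩

theorem contDiffOn_homogeneous {P : ℝ → ℝ} (hP : ContDiffOn ℝ 1 P (Ioo 0 1)) (s : ℝ) :
    ContDiffOn ℝ 1 (fun x => ‖x‖ ^ s * P (cosTo e x)) (offAxis e) := by
  have hsub : offAxis e ⊆ {x | x ≠ 0} := fun x hx =>
    ne_zero_of_mem_halfSpace (offAxis_subset e hx)
  exact ((contDiffOn_norm_rpow s).mono hsub).mul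
    (hP.comp ((contDiffOn_cosTo e).mono hsub) fun x hx => cosTo_mem_Ioo hx)

theorem continuousOn_homogeneous (he : ‖e‖ = 1) {P : ℝ → ℝ} (hP : ContinuousOn P (Ioc 0 1)) (s : ℝ) :
    ContinuousOn (fun x => ‖x‖ ^ s * P (cosTo e x)) (halfSpace e) := by
  have hsub : halfSpace e ⊆ {x | x ≠ 0} := fun x hx => ne_zero_of_mem_halfSpace hx
  exact ((contDiffOn_norm_rpow (n := 0) s).continuousOn.mono hsub).mul
    (hP.comp ((contDiffOn_cosTo (n := 0) e).continuousOn.mono hsub) fun x hx => cosTo_mem_Ioc he hx)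

/-- The divergence of the field `|x|^(m-1) P(t) x + |x|^m Q(t) e`. -/
theorem div_homogeneous_field (he : ‖e‖ = 1) {x : F} (hx : x ≠ 0) (m : ℝ) {P Q P₁ Q₁ : ℝ → ℝ}
    (hP : HasDerivAt P (P₁ (cosTo e x)) (cosTo e x))
    (hQ : HasDerivAt Q (Q₁ (cosTo e x)) (cosTo e x)) :
    Module.finrank ℝ F * (‖x‖ ^ (m - 1) * P (cosTo e x)) +
      fderiv ℝ (fun x => ‖x‖ ^ (m - 1) * P (cosTo e x)) x x +
      fderiv ℝ (fun x => ‖x‖ ^ m * Q (cosTo e x)) x e =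
    ‖x‖ ^ (m - 1) * ((m + Module.finrank ℝ F - 1) * P (cosTo e x) +
      m * cosTo e x * Q (cosTo e x) + (1 - cosTo e x ^ 2) * Q₁ (cosTo e x)) := by
  -- The radial coefficient is only differentiated along `x`, where Euler's identity gives a
  -- multiple of itself; hence `P₁` does not survive.
  rw [(hasFDerivAt_homogeneous he hx (m - 1) hP.hasDerivWithinAt).fderiv,
    (hasFDerivAt_homogeneous he hx m hQ.hasDerivWithinAt).fderiv, innerSL_apply_apply,
    innerSL_apply_apply, inner_homogeneousGrad_self e hx, inner_homogeneousGrad_axis he hx]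
  ring

end Field

/-! ### The axis is removable -/

section Cutoff

/-- The derivative lives on `1 ≤ s ≤ 2`. With `s = j (1 - t)` the bound does not depend on the
cutoff index `j`. -/
theorem exists_bound_deriv_smoothTransition :
    ∃ M, ∀ s : ℝ, |deriv Real.smoothTransition (s - 1) * s| ≤ M := by
  have hc : Continuous fun s => deriv Real.smoothTransition (s - 1) * s := by
    have : Continuous (deriv Real.smoothTransition) :=
      (Real.smoothTransition.contDiff (n := 1)).continuous_deriv le_rfl
    fun_prop
  have hs : HasCompactSupport fun s => deriv Real.smoothTransition (s - 1) * s := by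
    refine HasCompactSupport.intro (K := Icc 1 2) isCompact_Icc fun s hs => ?_
    have : deriv Real.smoothTransition (s - 1) = 0 := by
      rw [mem_Icc, not_and_or, not_le, not_le] at hs
      rcases hs with hs | hs
      · have : Real.smoothTransition =ᶠ[𝓝 (s - 1)] fun _ => 0 := by
          filter_upwards [Iio_mem_nhds (show s - 1 < 0 by linarith)] with y hy
          exact Real.smoothTransition.zero_of_nonpos hy.le
        rw [this.deriv_eq, deriv_const]
      · have : Real.smoothTransition =ᶠ[𝓝 (s - 1)] fun _ => 1 := by
          filter_upwards [Ioi_mem_nhds (show 1 < s - 1 by linarith)] with y hy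
          exact Real.smoothTransition.one_of_one_le hy.le
        rw [this.deriv_eq, deriv_const]
    rw [this, zero_mul]
  simpa using hc.bounded_above_of_compact_support hs

variable {F : Type*} [NormedAddCommGroup F] [InnerProductSpace ℝ F] {e : F}

/-- A cutoff function vanishing near the axis spanned by `e`. -/
noncomputable def axisCutoff (e : F) (j : ℕ) (x : F) : ℝ :=
  Real.smoothTransition (j * (1 - cosTo e x) - 1)

theorem contDiffAt_axisCutoff (j : ℕ) {x : F} (hx : x ≠ 0) : ContDiffAt ℝ 1 (axisCutoff e j) x := by
  have h1 : ContDiffAt ℝ 1 (cosTo e) x :=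
    (contDiffOn_cosTo e).contDiffAt (isOpen_ne.mem_nhds hx)
  exact (Real.smoothTransition.contDiff (n := 1)).contDiffAt.comp x
    ((contDiffAt_const.mul (contDiffAt_const.sub h1)).sub contDiffAt_const)

theorem hasFDerivAt_axisCutoff (j : ℕ) {x : F} (hx : x ≠ 0) :
    HasFDerivAt (axisCutoff e j)
      (-(deriv Real.smoothTransition (j * (1 - cosTo e x) - 1) * j) •
        (‖x‖⁻¹ • innerSL ℝ e - (cosTo e x * (‖x‖ ^ 2)⁻¹) • innerSL ℝ x)) x := by
  have h1 := ((hasFDerivAt_cosTo e hx).const_sub 1 |>.const_mul (j : ℝ)).sub_const 1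
  have h2 : HasDerivAt Real.smoothTransition
      (deriv Real.smoothTransition (j * (1 - cosTo e x) - 1)) (j * (1 - cosTo e x) - 1) :=
    ((Real.smoothTransition.contDiff (n := 1)).differentiable one_ne_zero _).hasDerivAt
  refine (h2.comp_hasFDerivAt x h1).congr_fderiv ?_
  rw [smul_smul, smul_neg, neg_smul]

/-- The cutoff depends only on direction, so it is constant along rays. -/
theorem fderiv_axisCutoff_self (j : ℕ) {x : F} (hx : x ≠ 0) :
    fderiv ℝ (axisCutoff e j) x x = 0 := by
  rw [(hasFDerivAt_axisCutoff j hx).fderiv]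
  have : ‖x‖ ≠ 0 := norm_ne_zero_iff.2 hx
  simp [inner_eq_cosTo_mul e x]
  field_simp
  simp

/-- Along `e` the derivative of `t` is `(1 - t²) / |x|`, and its factor `1 - t` absorbs the large
`j`. The gradient of the cutoff itself is unbounded in `j`, but the field only sees the directions
`x` and `e`. -/
theorem fderiv_axisCutoff_axis (he : ‖e‖ = 1) (j : ℕ) {x : F} (hx : x ≠ 0) :
    fderiv ℝ (axisCutoff e j) x e =
      -(deriv Real.smoothTransition (j * (1 - cosTo e x) - 1) * (j * (1 - cosTo e x))) *
        ((1 + cosTo e x) * ‖x‖⁻¹) := by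
  rw [(hasFDerivAt_axisCutoff j hx).fderiv]
  have : ‖x‖ ≠ 0 := norm_ne_zero_iff.2 hx
  simp [real_inner_comm e x, inner_eq_cosTo_mul e x, he]
  field_simp
  ring

theorem contDiff_mul_of_tsupport {φ χ : F → ℝ} (hφ : ContDiff ℝ 1 φ)
    (hχ : ∀ x ∈ tsupport φ, ContDiffAt ℝ 1 χ x) : ContDiff ℝ 1 fun x => φ x * χ x := by
  rw [contDiff_iff_contDiffAt]
  intro x
  by_cases hx : x ∈ tsupport φ
  · exact hφ.contDiffAt.mul (hχ x hx)
  · have h0 : φ =ᶠ[𝓝 x] 0 := notMem_tsupport_iff_eventuallyEq.1 hx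
    refine (contDiffAt_const (c := (0 : ℝ))).congr_of_eventuallyEq ?_
    filter_upwards [h0] with y hy
    simp [hy]

variable [FiniteDimensional ℝ F] [MeasurableSpace F] [BorelSpace F]

/-- Equality in Cauchy–Schwarz puts `x` on the line spanned by `e`, which is a proper subspace and
therefore null. -/
theorem ae_cosTo_lt_one (he : ‖e‖ = 1) (hdim : 2 ≤ Module.finrank ℝ F) :
    ∀ᵐ x : F, cosTo e x < 1 := by
  have hne : (Submodule.span ℝ {e}) ≠ ⊤ := by
    intro h
    have h1 := finrank_span_le_card (R := ℝ) ({e} : Set F)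
    rw [h, finrank_top] at h1
    simp at h1
    omega
  have h0 := Measure.addHaar_submodule (volume : Measure F) _ hne
  refine measure_mono_null (fun x hx => ?_) h0
  have h1 : cosTo e x = 1 := le_antisymm (cosTo_le_one he x) (not_lt.1 hx)
  have h2 : inner ℝ e x = ‖e‖ * ‖x‖ := by rw [inner_eq_cosTo_mul, h1, he]
  rw [inner_eq_norm_mul_iff_real, he, one_smul] at h2
  rw [← h2]
  exact Submodule.smul_mem _ _ (Submodule.mem_span_singleton_self e)

theorem integrable_field_mul_fderiv {U : Set F} {a b φ : F → ℝ} (ha : ContinuousOn a U)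
    (hb : ContinuousOn b U) (hφ : ContDiff ℝ 1 φ) (hc : HasCompactSupport φ)
    (hsub : tsupport φ ⊆ U) (e : F) :
    Integrable fun x => a x * fderiv ℝ φ x x + b x * fderiv ℝ φ x e := by
  have hd : Continuous (fderiv ℝ φ) := hφ.continuous_fderiv one_ne_zero
  have hts : ∀ v : F → F, tsupport (fun x => fderiv ℝ φ x (v x)) ⊆ tsupport φ := fun v => by
    refine closure_minimal (fun x hx => ?_) (isClosed_tsupport φ)
    exact support_fderiv_subset ℝ (fun h => hx (by simp [h]))
  have hcs : ∀ v : F → F, HasCompactSupport fun x => fderiv ℝ φ x (v x) := fun v =>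
    hc.mono' ((subset_tsupport _).trans (hts v))
  refine (integrable_mul_of_tsupport (ha.mono ((hts fun x => x).trans hsub))
    (hd.clm_apply continuous_id) (hcs fun x => x)).add
    (integrable_mul_of_tsupport (hb.mono ((hts fun _ => e).trans hsub))
      (hd.clm_apply continuous_const) (hcs fun _ => e))

/-- A continuous homogeneous axial field on the half-space that is divergence free off the axis
is weakly divergence free. -/
theorem integral_homogeneous_field_eq_zero (he : ‖e‖ = 1) (hdim : 2 ≤ Module.finrank ℝ F) {m : ℝ}
    {P Q Q₁ : ℝ → ℝ} (hPc : ContinuousOn P (Ioc 0 1)) (hQc : ContinuousOn Q (Ioc 0 1))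
    (hP : ContDiffOn ℝ 1 P (Ioo 0 1)) (hQ : ContDiffOn ℝ 1 Q (Ioo 0 1))
    (hQ₁ : ∀ t ∈ Ioo (0 : ℝ) 1, HasDerivAt Q (Q₁ t) t)
    (hdiv : ∀ t ∈ Ioo (0 : ℝ) 1, (m + Module.finrank ℝ F - 1) * P t + m * t * Q t +
      (1 - t ^ 2) * Q₁ t = 0)
    {φ : F → ℝ} (hφ : ContDiff ℝ 1 φ) (hc : HasCompactSupport φ) (hsub : tsupport φ ⊆ halfSpace e) :
    ∫ x, (‖x‖ ^ (m - 1) * P (cosTo e x) * fderiv ℝ φ x x +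
      ‖x‖ ^ m * Q (cosTo e x) * fderiv ℝ φ x e) = 0 := by
  set a : F → ℝ := fun x => ‖x‖ ^ (m - 1) * P (cosTo e x) with ha
  set b : F → ℝ := fun x => ‖x‖ ^ m * Q (cosTo e x) with hb
  have hac : ContinuousOn a (halfSpace e) := continuousOn_homogeneous he hPc _
  have hbc : ContinuousOn b (halfSpace e) := continuousOn_homogeneous he hQc _
  have hne : ∀ x ∈ tsupport φ, x ≠ 0 := fun x hx => ne_zero_of_mem_halfSpace (hsub hx)
  -- the truncated test functions
  set ψ : ℕ → F → ℝ := fun j x => φ x * axisCutoff e j x with hψ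
  have hψs : ∀ j, tsupport (ψ j) ⊆ tsupport φ := fun j => tsupport_mul_subset_left
  have hψd : ∀ j, ContDiff ℝ 1 (ψ j) := fun j =>
    contDiff_mul_of_tsupport hφ fun x hx => contDiffAt_axisCutoff j (hne x hx)
  have hψc : ∀ j, HasCompactSupport (ψ j) := fun j => hc.mul_right
  -- The shift to `j + 1` keeps the threshold `1 / (j + 1)` positive: the cutoff vanishes where `1 -
  -- t` is at most that.
  have hψoff : ∀ j, tsupport (ψ (j + 1)) ⊆ offAxis e := by
    intro j
    have hj : (0 : ℝ) < ((j + 1 : ℕ) : ℝ) := by positivity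
    have hcl : IsClosed (tsupport φ ∩
        {x | inner ℝ e x ≤ (1 - 1 / ((j + 1 : ℕ) : ℝ)) * ‖x‖}) :=
      (isClosed_tsupport φ).inter (isClosed_le (by fun_prop) (by fun_prop))
    refine (closure_minimal (fun x hx => ?_) hcl).trans fun x hx => ⟨hsub hx.1, ?_⟩
    · have h1 : x ∈ tsupport φ := hψs _ (subset_tsupport _ hx)
      refine ⟨h1, ?_⟩
      have h2 : axisCutoff e (j + 1) x ≠ 0 := right_ne_zero_of_mul hx
      have h3 : 0 < ((j + 1 : ℕ) : ℝ) * (1 - cosTo e x) - 1 := by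
        by_contra! h; exact h2 (Real.smoothTransition.zero_of_nonpos h)
      have h4 : cosTo e x ≤ 1 - 1 / ((j + 1 : ℕ) : ℝ) := by
        have : 1 / ((j + 1 : ℕ) : ℝ) ≤ 1 - cosTo e x := by
          rw [div_le_iff₀ hj]; linarith
        linarith
      rw [mem_ofPred_eq, inner_eq_cosTo_mul]
      exact mul_le_mul_of_nonneg_right h4 (norm_nonneg x)
    · have h0 := norm_pos_iff.2 (hne x hx.1)
      have h1 : 0 < 1 / ((j + 1 : ℕ) : ℝ) := by positivity
      have h2 : inner ℝ e x ≤ (1 - 1 / ((j + 1 : ℕ) : ℝ)) * ‖x‖ := hx.2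
      nlinarith
  have hzero : ∀ j, ∫ x, (a x * fderiv ℝ (ψ (j + 1)) x x + b x * fderiv ℝ (ψ (j + 1)) x e) = 0 := by
    intro j
    rw [integral_field_eq_neg_integral_div (isOpen_offAxis e) (contDiffOn_homogeneous hP (m - 1))
      (contDiffOn_homogeneous hQ m) (hψd _) (hψc _) (hψoff j) e, neg_eq_zero]
    refine integral_eq_zero_of_ae (Eventually.of_forall fun x => ?_)
    by_cases hx : x ∈ tsupport (ψ (j + 1))
    · have ht := cosTo_mem_Ioo (hψoff j hx)
      have hPd : HasDerivAt P (deriv P (cosTo e x)) (cosTo e x) :=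
        ((hP.differentiableOn one_ne_zero).differentiableAt (Ioo_mem_nhds ht.1 ht.2)).hasDerivAt
      beta_reduce
      rw [div_homogeneous_field he (hne x (hψs _ hx)) m (P₁ := deriv P) hPd (hQ₁ _ ht),
        hdiv _ ht, mul_zero, mul_zero, Pi.zero_apply]
    · simp [image_eq_zero_of_notMem_tsupport hx]
  -- the truncated integrands
  have hint : ∀ j x, a x * fderiv ℝ (ψ j) x x + b x * fderiv ℝ (ψ j) x e =
      axisCutoff e j x * (a x * fderiv ℝ φ x x + b x * fderiv ℝ φ x e) -
      b x * ‖x‖⁻¹ * φ x * ((1 + cosTo e x) *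
        (deriv Real.smoothTransition (j * (1 - cosTo e x) - 1) * (j * (1 - cosTo e x)))) := by
    intro j x
    by_cases hx : x ∈ tsupport φ
    · have h1 : fderiv ℝ (ψ j) x = _ :=
        ((hφ.differentiable one_ne_zero x).hasFDerivAt.mul
          ((contDiffAt_axisCutoff (e := e) j (hne x hx)).differentiableAt
            one_ne_zero).hasFDerivAt).fderiv
      rw [h1]
      simp only [add_apply, smul_apply, smul_eq_mul,
        fderiv_axisCutoff_self j (hne x hx), fderiv_axisCutoff_axis he j (hne x hx)]
      ring
    · have h1 : x ∉ tsupport (ψ j) := fun h => hx (hψs j h)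
      rw [fderiv_of_notMem_tsupport ℝ h1, fderiv_of_notMem_tsupport ℝ hx,
        image_eq_zero_of_notMem_tsupport hx]
      simp
  obtain ⟨M, hM⟩ := exists_bound_deriv_smoothTransition
  set G : F → ℝ := fun x => a x * fderiv ℝ φ x x + b x * fderiv ℝ φ x e with hG
  have hGi : Integrable G := integrable_field_mul_fderiv hac hbc hφ hc hsub e
  have hBi : Integrable fun x => b x * ‖x‖⁻¹ * φ x :=
    integrable_mul_of_tsupport ((hbc.mono hsub).mul (continuousOn_id.norm.inv₀ fun x hx =>
      norm_ne_zero_iff.2 (hne x hx))) hφ.continuous hc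
  have hlim : Tendsto (fun j : ℕ => ∫ x, (a x * fderiv ℝ (ψ (j + 1)) x x +
      b x * fderiv ℝ (ψ (j + 1)) x e)) atTop (𝓝 (∫ x, G x)) := by
    -- The factor `2 * M` bounds `1 + t ≤ 2` times the scale-invariant cutoff derivative, uniformly
    -- in `j`.
    refine tendsto_integral_of_dominated_convergence
      (fun x => ‖G x‖ + ‖b x * ‖x‖⁻¹ * φ x‖ * (2 * M)) (fun j => ?_)
      (hGi.norm.add (hBi.norm.mul_const _)) (fun j => Eventually.of_forall fun x => ?_) ?_
    · exact (integrable_field_mul_fderiv hac hbc (hψd _) (hψc _) ((hψs _).trans hsub)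
        e).aestronglyMeasurable
    · rw [hint]
      refine (norm_sub_le _ _).trans (add_le_add ?_ ?_)
      · rw [norm_mul]
        refine mul_le_of_le_one_left (norm_nonneg _) ?_
        rw [axisCutoff, Real.norm_eq_abs, abs_of_nonneg (Real.smoothTransition.nonneg _)]
        exact Real.smoothTransition.le_one _
      · by_cases hx : x ∈ tsupport φ
        · rw [norm_mul]
          refine mul_le_mul_of_nonneg_left ?_ (norm_nonneg _)
          have ht := cosTo_mem_Ioc he (hsub hx)
          rw [Real.norm_eq_abs, abs_mul, abs_of_pos (by linarith [ht.1])]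
          exact mul_le_mul (by linarith [ht.2]) (hM _) (abs_nonneg _) (by norm_num)
        · simp [image_eq_zero_of_notMem_tsupport hx]
    · filter_upwards [ae_cosTo_lt_one he hdim] with x hx
      -- Off the axis the cutoff is eventually `1` near the point, so its derivative vanishes there.
      have h1 : ∀ᶠ j : ℕ in atTop, 2 < ((j + 1 : ℕ) : ℝ) * (1 - cosTo e x) := by
        have : Tendsto (fun j : ℕ => ((j + 1 : ℕ) : ℝ) * (1 - cosTo e x)) atTop atTop :=
          (tendsto_natCast_atTop_atTop.comp (tendsto_add_atTop_nat 1)).atTop_mul_const (by linarith)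
        exact this.eventually_gt_atTop 2
      refine tendsto_const_nhds.congr' ?_
      filter_upwards [h1] with j hj
      have h2 : Real.smoothTransition =ᶠ[𝓝 (((j + 1 : ℕ) : ℝ) * (1 - cosTo e x) - 1)]
          fun _ => 1 := by
        filter_upwards [Ioi_mem_nhds (show 1 < ((j + 1 : ℕ) : ℝ) * (1 - cosTo e x) - 1 by
          linarith)] with y hy
        exact Real.smoothTransition.one_of_one_le (le_of_lt hy)
      rw [hint, h2.deriv_eq, deriv_const, axisCutoff, h2.eq_of_nhds]
      simp [hG]
  exact tendsto_nhds_unique hlim (by simp only [hzero]; exact tendsto_const_nhds)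

end Cutoff

/-! ### The concrete half-space, and classical gradients as weak gradients -/

section Bridge

variable {N : ℕ} (hN : 2 ≤ N)

/-- The unit vector of the last coordinate axis. -/
noncomputable def lastVector : EuclideanSpace ℝ (Fin N) :=
  EuclideanSpace.single (lastIndex N hN) (1 : ℝ)

theorem norm_lastVector : ‖lastVector hN‖ = 1 := by simp [lastVector]

theorem inner_lastVector (x : EuclideanSpace ℝ (Fin N)) :
    inner ℝ (lastVector hN) x = x (lastIndex N hN) := by
  simp [lastVector, EuclideanSpace.inner_single_left]

theorem upperHalfSpace_eq : upperHalfSpace N hN = halfSpace (lastVector hN) := by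
  ext x
  simp only [upperHalfSpace, halfSpace, mem_ofPred_eq, inner_lastVector]

theorem quasiradial_eq (k : ℝ) (f : ℝ → ℝ) :
    quasiradial N hN k f =
      fun x => ‖x‖ ^ k * (fun t => f (Real.arccos t)) (cosTo (lastVector hN) x) := by
  ext x
  rw [quasiradial, InnerProductGeometry.angle, cosTo, real_inner_comm]
  change _ * f (Real.arccos (_ / (‖x‖ * ‖lastVector hN‖))) = _
  rw [norm_lastVector, mul_one]
  rfl

end Bridge

theorem memLpLoc_of_continuousOn {N : ℕ} {G : Type*} [NormedAddCommGroup G] {p : ℝ}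
    {Ω : Set (EuclideanSpace ℝ (Fin N))} {g : EuclideanSpace ℝ (Fin N) → G}
    [SecondCountableTopology G] (hg : ContinuousOn g Ω) : MemLpLoc p Ω g := by
  intro K hK hKΩ
  have hgK := hg.mono hKΩ
  obtain ⟨C, hC⟩ := hK.exists_bound_of_continuousOn hgK
  have : IsFiniteMeasure (volume.restrict K) := ⟨by
    rw [Measure.restrict_apply_univ]; exact hK.measure_lt_top⟩
  refine MemLp.of_bound (hgK.aestronglyMeasurable hK.measurableSet) C ?_
  exact (ae_restrict_iff' hK.measurableSet).2 (Eventually.of_forall hC)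

/-- A classical `C¹` gradient is a weak gradient. -/
theorem isWeakGradient_of_hasFDerivAt {N : ℕ} {Ω : Set (EuclideanSpace ℝ (Fin N))} (hΩ : IsOpen Ω)
    {u : EuclideanSpace ℝ (Fin N) → ℝ} {g : EuclideanSpace ℝ (Fin N) → EuclideanSpace ℝ (Fin N)}
    (hu : ∀ x ∈ Ω, HasFDerivAt u (innerSL ℝ (g x)) x) (hg : ContinuousOn g Ω) :
    IsWeakGradient Ω u g := by
  have hu1 : ContDiffOn ℝ 1 u Ω := by
    rw [show (1 : WithTop ℕ∞) = 0 + 1 by norm_num, contDiffOn_succ_iff_fderiv_of_isOpen hΩ]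
    refine ⟨fun x hx => (hu x hx).differentiableAt.differentiableWithinAt, by simp, ?_⟩
    rw [contDiffOn_zero]
    exact ((innerSL ℝ).continuous.comp_continuousOn hg).congr fun x hx => (hu x hx).fderiv
  intro φ hφ hc hsub v
  have h := (integral_mul_fderiv_of_tsupport_subset hΩ hu1 (hφ.of_le (by exact_mod_cast le_top))
    hc hsub v).2.2
  rw [setIntegral_eq_integral_of_forall_compl_eq_zero, h,
    setIntegral_eq_integral_of_forall_compl_eq_zero]
  · congr 1
    refine integral_congr_ae (Eventually.of_forall fun x => ?_)
    by_cases hx : x ∈ tsupport φ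
    · simp only [(hu x (hsub hx)).fderiv, innerSL_apply_apply]
    · simp [image_eq_zero_of_notMem_tsupport hx]
  · intro x hx
    rw [image_eq_zero_of_notMem_tsupport fun h => hx (hsub h), zero_mul]
  · intro x hx
    rw [fderiv_of_notMem_tsupport ℝ fun h => hx (hsub h)]
    simp

/-! ### From the angular equation to `p`-harmonicity -/

section Existence

variable {f f₁ f₂ : ℝ → ℝ} {q c n β : ℝ}

theorem contDiffOn_one_Ioo {g g' : ℝ → ℝ} {a b : ℝ} (hg : ∀ θ ∈ Ioo a b, HasDerivAt g (g' θ) θ)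
    (hc : ContinuousOn g' (Ioo a b)) : ContDiffOn ℝ 1 g (Ioo a b) := by
  rw [show (1 : WithTop ℕ∞) = 0 + 1 by norm_num, contDiffOn_succ_iff_deriv_of_isOpen isOpen_Ioo]
  refine ⟨fun x hx => (hg x hx).differentiableAt.differentiableWithinAt, by simp, ?_⟩
  rw [contDiffOn_zero]
  exact hc.congr fun x hx => (hg x hx).deriv

/-- As a function of `θ` this is `-f₁ / sin`, which tends to `-f₂ 0` at the pole because `f₁ 0 = 0`.
-/
theorem continuousOn_cosProfileDeriv
    (hf₁ : ∀ θ ∈ Icc 0 (Real.pi / 2), HasDerivWithinAt f₁ (f₂ θ) (Icc 0 (Real.pi / 2)) θ)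
    (h0 : f₁ 0 = 0) : ContinuousOn (cosProfileDeriv f₁ f₂) (Ioc 0 1) := by
  have hpi := Real.pi_pos
  set κ : ℝ → ℝ := Function.update (fun θ => -f₁ θ / Real.sin θ) 0 (-f₂ 0) with hκ
  have hκc : ContinuousOn κ (Icc 0 (Real.pi / 2)) := by
    intro θ hθ
    rcases eq_or_ne θ 0 with rfl | hne
    · rw [hκ, continuousWithinAt_update_same]
      have h1 := (hasDerivWithinAt_iff_tendsto_slope.1 (hf₁ 0 hθ))
      have h2 : Tendsto Real.sinc (𝓝[Icc 0 (Real.pi / 2) \ {0}] 0) (𝓝 1) := by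
        have := (Real.continuous_sinc.tendsto 0).mono_left
          (nhdsWithin_le_nhds (s := Icc 0 (Real.pi / 2) \ {0}))
        rwa [Real.sinc_zero] at this
      have h3 := h1.neg.div h2 one_ne_zero
      rw [div_one] at h3
      refine h3.congr' ?_
      filter_upwards [self_mem_nhdsWithin] with s hs
      have hs0 : s ≠ 0 := hs.2
      have hsin : Real.sin s ≠ 0 := (Real.sin_pos_of_pos_of_lt_pi
        (lt_of_le_of_ne hs.1.1 hs0.symm) (by linarith [hs.1.2])).ne'
      simp only [Pi.div_apply]
      rw [slope_def_field, h0, Real.sinc_of_ne_zero hs0]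
      field_simp
      simp
    · have hsin : Real.sin θ ≠ 0 := (Real.sin_pos_of_pos_of_lt_pi
        (lt_of_le_of_ne hθ.1 hne.symm) (by linarith [hθ.2])).ne'
      rw [hκ, continuousWithinAt_update_of_ne hne]
      exact (hf₁ θ hθ).continuousWithinAt.neg.div Real.continuous_sin.continuousWithinAt hsin
  have hmaps : MapsTo Real.arccos (Ioc 0 1) (Icc 0 (Real.pi / 2)) := fun t ht =>
    ⟨Real.arccos_nonneg t, Real.arccos_le_pi_div_two.2 ht.1.le⟩
  refine (hκc.comp Real.continuous_arccos.continuousOn hmaps).congr fun t ht => ?_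
  rw [cosProfileDeriv, Function.comp_apply, hκ]
  split_ifs with h1
  · rw [h1, Real.arccos_one, Function.update_self]
  · rw [Function.update_of_ne, Real.sin_arccos]
    exact (Real.arccos_pos.2 (lt_of_le_of_ne ht.2 h1)).ne'

/-- `arccos` is not differentiable at `1`, but the derivative of the composite has a limit there,
and that limit is the one-sided derivative. -/
theorem hasDerivWithinAt_cosProfile
    (hf : ∀ θ ∈ Icc 0 (Real.pi / 2), HasDerivWithinAt f (f₁ θ) (Icc 0 (Real.pi / 2)) θ)
    (hf₁ : ∀ θ ∈ Icc 0 (Real.pi / 2), HasDerivWithinAt f₁ (f₂ θ) (Icc 0 (Real.pi / 2)) θ)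
    (h0 : f₁ 0 = 0) {t : ℝ} (ht : t ∈ Ioc (0 : ℝ) 1) :
    HasDerivWithinAt (fun t => f (Real.arccos t)) (cosProfileDeriv f₁ f₂ t) (Iic 1) t := by
  have hint : ∀ s ∈ Ioo (0 : ℝ) 1,
      HasDerivAt (fun t => f (Real.arccos t)) (cosProfileDeriv f₁ f₂ s) s := fun s hs =>
    hasDerivAt_cosProfile (fun θ hθ => (hf θ (Ioo_subset_Icc_self hθ)).hasDerivAt
      (Icc_mem_nhds hθ.1 hθ.2)) hs
  rcases ht.2.eq_or_lt with rfl | h1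
  · refine hasDerivWithinAt_Iic_of_tendsto_deriv (s := Ioo 0 1)
      (fun s hs => (hint s hs).differentiableAt.differentiableWithinAt) ?_
      (Ioo_mem_nhdsLT one_pos) ?_
    · have hc : ContinuousOn f (Icc 0 (Real.pi / 2)) := fun θ hθ => (hf θ hθ).continuousWithinAt
      have hmaps : MapsTo Real.arccos (Ioc 0 1) (Icc 0 (Real.pi / 2)) := fun t ht =>
        ⟨Real.arccos_nonneg t, Real.arccos_le_pi_div_two.2 ht.1.le⟩
      exact (hc.comp Real.continuous_arccos.continuousOn hmaps 1 ⟨one_pos, le_rfl⟩).mono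
        Ioo_subset_Ioc_self
    · have h2 := ((continuousOn_cosProfileDeriv hf₁ h0) 1 ⟨one_pos, le_rfl⟩).mono
        (show Ioo (0 : ℝ) 1 ⊆ Ioc 0 1 from Ioo_subset_Ioc_self)
      rw [ContinuousWithinAt, nhdsWithin_Ioo_eq_nhdsLT one_pos] at h2
      refine h2.congr' ?_
      filter_upwards [Ioo_mem_nhdsLT one_pos] with s hs
      exact (hint s hs).deriv.symm
  · exact (hint t ⟨ht.1, h1⟩).hasDerivWithinAt

theorem continuousOn_homogeneousGrad {F : Type*} [NormedAddCommGroup F] [InnerProductSpace ℝ F]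
    {e : F} (he : ‖e‖ = 1) {P P₁ : ℝ → ℝ} (hP : ContinuousOn P (Ioc 0 1))
    (hP₁ : ContinuousOn P₁ (Ioc 0 1)) (s : ℝ) :
    ContinuousOn (homogeneousGrad e s P P₁) (halfSpace e) :=
  ((continuousOn_homogeneous he ((continuousOn_const.mul hP).sub (continuousOn_id.mul hP₁))
    (s - 2)).smul continuousOn_id).add
    ((continuousOn_homogeneous he hP₁ (s - 1)).smul continuousOn_const)

/-- A positive `C²` function `f` on `[0, π/2)` with derivatives `f₁`, `f₂` and `f₁ 0 = 0`. -/
structure IsRegularProfile (f f₁ f₂ : ℝ → ℝ) : Prop where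
  deriv : ∀ θ ∈ Icc 0 (Real.pi / 2), HasDerivWithinAt f (f₁ θ) (Icc 0 (Real.pi / 2)) θ
  deriv₁ : ∀ θ ∈ Icc 0 (Real.pi / 2), HasDerivWithinAt f₁ (f₂ θ) (Icc 0 (Real.pi / 2)) θ
  cont₂ : ContinuousOn f₂ (Icc 0 (Real.pi / 2))
  zero₁ : f₁ 0 = 0
  pos : ∀ θ ∈ Ico 0 (Real.pi / 2), 0 < f θ

namespace IsRegularProfile

theorem hasDerivAt (h : IsRegularProfile f f₁ f₂) {θ : ℝ} (hθ : θ ∈ Ioo 0 (Real.pi / 2)) :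
    HasDerivAt f (f₁ θ) θ :=
  (h.deriv θ (Ioo_subset_Icc_self hθ)).hasDerivAt (Icc_mem_nhds hθ.1 hθ.2)

theorem hasDerivAt₁ (h : IsRegularProfile f f₁ f₂) {θ : ℝ} (hθ : θ ∈ Ioo 0 (Real.pi / 2)) :
    HasDerivAt f₁ (f₂ θ) θ :=
  (h.deriv₁ θ (Ioo_subset_Icc_self hθ)).hasDerivAt (Icc_mem_nhds hθ.1 hθ.2)

theorem continuousOn_cosProfile (h : IsRegularProfile f f₁ f₂) :
    ContinuousOn (fun t => f (Real.arccos t)) (Ioc 0 1) := fun _ ht =>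
  (hasDerivWithinAt_cosProfile h.deriv h.deriv₁ h.zero₁ ht).continuousWithinAt.mono
    fun _ hs => hs.2

theorem speedSq_pos (h : IsRegularProfile f f₁ f₂) {k : ℝ} (hk : k ≠ 0) {t : ℝ}
    (ht : t ∈ Ioc (0 : ℝ) 1) :
    0 < speedSq k (fun t => f (Real.arccos t)) (cosProfileDeriv f₁ f₂) t := by
  have h1 : 0 < f (Real.arccos t) :=
    h.pos _ ⟨Real.arccos_nonneg t, Real.arccos_lt_pi_div_two.2 ht.1⟩
  have h2 : 0 ≤ 1 - t ^ 2 := by nlinarith [ht.1, ht.2]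
  exact add_pos_of_pos_of_nonneg (by positivity) (by positivity)

theorem hasFDerivAt (h : IsRegularProfile f f₁ f₂) {F : Type*} [NormedAddCommGroup F]
    [InnerProductSpace ℝ F] {e : F} (he : ‖e‖ = 1) (k : ℝ) {x : F} (hx : x ∈ halfSpace e) :
    HasFDerivAt (fun x => ‖x‖ ^ k * (fun t => f (Real.arccos t)) (cosTo e x))
      (innerSL ℝ (homogeneousGrad e k (fun t => f (Real.arccos t)) (cosProfileDeriv f₁ f₂) x)) x :=
  hasFDerivAt_homogeneous he (ne_zero_of_mem_halfSpace hx) k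
    (hasDerivWithinAt_cosProfile h.deriv h.deriv₁ h.zero₁ (cosTo_mem_Ioc he hx))

theorem continuousOn_grad (h : IsRegularProfile f f₁ f₂) {F : Type*} [NormedAddCommGroup F]
    [InnerProductSpace ℝ F] {e : F} (he : ‖e‖ = 1) (k : ℝ) :
    ContinuousOn (homogeneousGrad e k (fun t => f (Real.arccos t)) (cosProfileDeriv f₁ f₂))
      (halfSpace e) :=
  continuousOn_homogeneousGrad he h.continuousOn_cosProfile
    (continuousOn_cosProfileDeriv h.deriv₁ h.zero₁) k

theorem contDiffOn_flux (h : IsRegularProfile f f₁ f₂) (p : ℝ) {k : ℝ} (hk : k ≠ 0) :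
    ContDiffOn ℝ 1 (axialFlux p k (fun t => f (Real.arccos t)) (cosProfileDeriv f₁ f₂))
      (Ioo 0 1) ∧
    ContDiffOn ℝ 1 (radialFlux p k (fun t => f (Real.arccos t)) (cosProfileDeriv f₁ f₂))
      (Ioo 0 1) :=
  _root_.contDiffOn_flux
    (contDiffOn_one_Ioo (fun _ hθ => h.hasDerivAt hθ) fun _ hθ =>
      (h.hasDerivAt₁ hθ).continuousAt.continuousWithinAt)
    (contDiffOn_one_Ioo (fun _ hθ => h.hasDerivAt₁ hθ) (h.cont₂.mono Ioo_subset_Icc_self))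
    (fun θ hθ => h.pos θ (Ioo_subset_Ico_self hθ)) hk

theorem exists_hasDerivAt_axialFlux (h : IsRegularProfile f f₁ f₂) (p : ℝ) {k : ℝ} (hk : k ≠ 0)
    (ν : ℝ) {t : ℝ} (ht : t ∈ Ioo (0 : ℝ) 1) :
    ∃ w > 0, ((k - 1) * (p - 1) + ν - 1) *
          radialFlux p k (fun t => f (Real.arccos t)) (cosProfileDeriv f₁ f₂) t +
        (k - 1) * (p - 1) * t *
          axialFlux p k (fun t => f (Real.arccos t)) (cosProfileDeriv f₁ f₂) t +
        (1 - t ^ 2) *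
          _root_.deriv (axialFlux p k (fun t => f (Real.arccos t)) (cosProfileDeriv f₁ f₂)) t =
        w * angularOp (p - 1) (p - ν) (ν - 2) (-k) (Real.arccos t)
          (f (Real.arccos t)) (f₁ (Real.arccos t)) (f₂ (Real.arccos t)) := by
  obtain ⟨Q', hQ', w, hw⟩ := _root_.exists_hasDerivAt_axialFlux (p := p)
    (fun _ hθ => h.hasDerivAt hθ) (fun _ hθ => h.hasDerivAt₁ hθ)
    (fun θ hθ => h.pos θ (Ioo_subset_Ico_self hθ)) hk ν ht
  exact ⟨w, by rwa [hQ'.deriv]⟩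

/-- The flux of the quasiradial function, tested with a gradient. -/
theorem inner_flux_gradient (h : IsRegularProfile f f₁ f₂) {F : Type*} [NormedAddCommGroup F]
    [InnerProductSpace ℝ F] [CompleteSpace F] {e : F} (he : ‖e‖ = 1) (p : ℝ) {k : ℝ} (hk : k ≠ 0)
    {φ : F → ℝ} (hsub : tsupport φ ⊆ halfSpace e) (x : F) :
    inner ℝ (‖homogeneousGrad e k (fun t => f (Real.arccos t)) (cosProfileDeriv f₁ f₂) x‖ ^ (p - 2) •
        homogeneousGrad e k (fun t => f (Real.arccos t)) (cosProfileDeriv f₁ f₂) x)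
        (gradient φ x) =
      ‖x‖ ^ ((k - 1) * (p - 1) - 1) * radialFlux p k (fun t => f (Real.arccos t))
          (cosProfileDeriv f₁ f₂) (cosTo e x) * fderiv ℝ φ x x +
        ‖x‖ ^ ((k - 1) * (p - 1)) * axialFlux p k (fun t => f (Real.arccos t))
          (cosProfileDeriv f₁ f₂) (cosTo e x) * fderiv ℝ φ x e := by
  by_cases hx : x ∈ tsupport φ
  · rw [flux_homogeneousGrad he (ne_zero_of_mem_halfSpace (hsub hx)) p k
      (h.speedSq_pos hk (cosTo_mem_Ioc he (hsub hx))), inner_gradient_right]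
    simp
  · rw [inner_gradient_right, fderiv_of_notMem_tsupport ℝ hx]
    simp

/-- The quasiradial function of a solution of the angular equation is `p`-harmonic. -/
theorem isPHarmonic (h : IsRegularProfile f f₁ f₂) {p k : ℝ} {N : ℕ} (hN : 2 ≤ N) (hk : k ≠ 0)
    (hode : ∀ θ ∈ Ioo 0 (Real.pi / 2),
      angularOp (p - 1) (p - N) (N - 2) (-k) θ (f θ) (f₁ θ) (f₂ θ) = 0) :
    IsPHarmonic p (upperHalfSpace N hN) (quasiradial N hN k f) := by
  rw [upperHalfSpace_eq, quasiradial_eq]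
  set e := lastVector hN
  have he : ‖e‖ = 1 := norm_lastVector hN
  set g : ℝ → ℝ := fun t => f (Real.arccos t)
  set g₁ := cosProfileDeriv f₁ f₂
  have hg₁c : ContinuousOn g₁ (Ioc 0 1) := continuousOn_cosProfileDeriv h.deriv₁ h.zero₁
  have hgc : ContinuousOn g (Ioc 0 1) := h.continuousOn_cosProfile
  have hWc : ContinuousOn (fun t => speedSq k g g₁ t ^ ((p - 2) / 2)) (Ioc 0 1) := by
    refine ContinuousOn.rpow_const ?_ fun t ht => Or.inl (h.speedSq_pos hk ht).ne'
    exact (continuousOn_const.mul (hgc.pow 2)).add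
      ((continuousOn_const.sub (continuousOn_id.pow 2)).mul (hg₁c.pow 2))
  have hQc : ContinuousOn (axialFlux p k g g₁) (Ioc 0 1) := hWc.mul hg₁c
  have hPc : ContinuousOn (radialFlux p k g g₁) (Ioc 0 1) :=
    hWc.mul ((continuousOn_const.mul hgc).sub (continuousOn_id.mul hg₁c))
  have hGc := h.continuousOn_grad he k
  refine ⟨homogeneousGrad e k g g₁, memLpLoc_of_continuousOn (continuousOn_homogeneous he hgc k),
    memLpLoc_of_continuousOn hGc,
    isWeakGradient_of_hasFDerivAt (isOpen_halfSpace e) (fun x hx => h.hasFDerivAt he k hx) hGc, ?_⟩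
  intro φ hφ hc hsub
  have hfin : Module.finrank ℝ (EuclideanSpace ℝ (Fin N)) = N := by simp
  obtain ⟨hQ1, hP1⟩ := h.contDiffOn_flux p hk
  have key := integral_homogeneous_field_eq_zero he (by rw [hfin]; exact hN)
    (m := (k - 1) * (p - 1)) (Q₁ := _root_.deriv (axialFlux p k g g₁)) hPc hQc hP1 hQ1
    (fun t ht => ((hQ1.differentiableOn one_ne_zero).differentiableAt
      (Ioo_mem_nhds ht.1 ht.2)).hasDerivAt)
    (fun t ht => by
      obtain ⟨w, -, hw⟩ := h.exists_hasDerivAt_axialFlux p hk N ht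
      rw [hfin, hw, hode _ (arccos_mem_Ioo ht), mul_zero])
    (hφ.of_le (by exact_mod_cast le_top)) hc hsub
  rw [← key, setIntegral_eq_integral_of_forall_compl_eq_zero]
  · exact integral_congr_ae (Eventually.of_forall fun x => h.inner_flux_gradient he p hk hsub x)
  · intro x hx
    rw [inner_gradient_right, fderiv_of_notMem_tsupport ℝ fun h => hx (hsub h)]
    simp

end IsRegularProfile

end Existence

/-! ### Comparison of two exponents -/

namespace IsAngularSolution

variable {f f₁ f₂ : ℝ → ℝ} {q c n β : ℝ}

/-- The second derivative at the pole, obtained as a limit of the angular equation. -/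
theorem second_deriv_zero (h : IsAngularSolution q c n β f f₁ f₂) (hβ : β ≠ 0) :
    (n + 1) * f₂ 0 = -(β * (q * β + c)) := by
  have hpi := Real.pi_pos
  have h0 : (0 : ℝ) ∈ Icc 0 (Real.pi / 2) := ⟨le_rfl, by positivity⟩
  have hle : 𝓝[>] (0 : ℝ) ≤ 𝓝[Icc 0 (Real.pi / 2) \ {0}] 0 := by
    rw [← nhdsWithin_Ioo_eq_nhdsGT (show (0 : ℝ) < Real.pi / 2 by positivity)]
    exact nhdsWithin_mono _ fun s hs => ⟨Ioo_subset_Icc_self hs, hs.1.ne'⟩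
  have hle' : 𝓝[>] (0 : ℝ) ≤ 𝓝[Icc 0 (Real.pi / 2)] 0 :=
    hle.trans (nhdsWithin_mono _ sdiff_subset)
  have hid : Tendsto (fun θ : ℝ => θ) (𝓝[>] 0) (𝓝 0) := nhdsWithin_le_nhds
  have tf : Tendsto f (𝓝[>] 0) (𝓝 1) := by
    rw [← h.zero]; exact (h.deriv 0 h0).continuousWithinAt.mono_left hle'
  have tf₁ : Tendsto f₁ (𝓝[>] 0) (𝓝 0) := by
    have := (h.deriv₁ 0 h0).continuousWithinAt.mono_left hle'
    rwa [h.zero₁] at this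
  have tf₂ : Tendsto f₂ (𝓝[>] 0) (𝓝 (f₂ 0)) := (h.cont₂ 0 h0).mono_left hle'
  have tcot : Tendsto (fun θ => Real.cos θ / Real.sin θ * f₁ θ) (𝓝[>] 0) (𝓝 (f₂ 0)) := by
    have h1 := (hasDerivWithinAt_iff_tendsto_slope.1 (h.deriv₁ 0 h0)).mono_left hle
    have h2 := ((h1.mul ((Real.continuous_cos.tendsto 0).comp hid))).div
      ((Real.continuous_sinc.tendsto 0).comp hid) (by simp)
    rw [Real.cos_zero, Real.sinc_zero, mul_one, div_one] at h2
    refine h2.congr' ?_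
    filter_upwards [IsPhase.eventually_mem_Ioo] with s hs
    have hsin : Real.sin s ≠ 0 :=
      (Real.sin_pos_of_pos_of_lt_pi hs.1 (by linarith [hs.2])).ne'
    have hs0 := hs.1.ne'
    simp only [Pi.div_apply, Function.comp_apply]
    rw [slope_def_field, h.zero₁, Real.sinc_of_ne_zero hs0]
    field_simp
    simp
  have tA := ((tf.pow 2).const_mul (β ^ 2)).add (tf₁.pow 2)
  have lim := (((tA.add ((tf₁.pow 2).const_mul (q - 1))).mul tf₂).add
    ((tf.const_mul ((q - 1) * β ^ 2)).mul (tf₁.pow 2))).add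
    (((tcot.const_mul n).add (tf.const_mul (β * (q * β + c)))).mul tA)
  have hz := tendsto_nhds_unique (tendsto_const_nhds.congr' (by
    filter_upwards [IsPhase.eventually_mem_Ioo] with s hs
    have := h.ode s hs
    rw [angularOp, mul_assoc n] at this
    exact this.symm)) lim
  -- Since `cot θ * f₁ → f₂ 0`, the limit equation is `β²` times the claim; this is where `n + 1`
  -- arises.
  apply mul_left_cancel₀ (pow_ne_zero 2 hβ)
  linear_combination -hz

/-- The Riccati equation for `G = -f'/(β f)`. -/
theorem riccati (h : IsAngularSolution q c n β f f₁ f₂) (hβ : β ≠ 0) {θ : ℝ}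
    (hθ : θ ∈ Ioo 0 (Real.pi / 2)) (hf : f θ ≠ 0) {G : ℝ} (hG : f₁ θ = -β * G * f θ) :
    -((f₂ θ * f θ - f₁ θ ^ 2) / (β * f θ ^ 2)) * (1 + q * G ^ 2) =
      (1 + G ^ 2) * (q * β * (1 + G ^ 2) + c - n * (Real.cos θ / Real.sin θ) * G) := by
  have h1 := h.ode θ hθ
  rw [angularOp, hG] at h1
  rw [hG]
  generalize Real.cos θ / Real.sin θ = k at *
  field_simp
  apply mul_left_cancel₀ (pow_ne_zero 2 hβ)
  apply mul_left_cancel₀ (pow_ne_zero 2 hf)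
  apply mul_left_cancel₀ hf
  linear_combination -f θ * h1

theorem hasDerivWithinAt_log (h : IsAngularSolution q c n β f f₁ f₂) {θ : ℝ}
    (hθ : θ ∈ Icc 0 (Real.pi / 2)) (hf : f θ ≠ 0) :
    HasDerivWithinAt (fun s => Real.log (f s) / β) (f₁ θ / f θ / β) (Icc 0 (Real.pi / 2)) θ :=
  ((h.deriv θ hθ).log hf).div_const β

theorem hasDerivWithinAt_logDeriv (h : IsAngularSolution q c n β f f₁ f₂) {θ : ℝ}
    (hθ : θ ∈ Icc 0 (Real.pi / 2)) (hf : f θ ≠ 0) :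
    HasDerivWithinAt (fun s => f₁ s / f s / β) ((f₂ θ * f θ - f₁ θ ^ 2) / (β * f θ ^ 2))
      (Icc 0 (Real.pi / 2)) θ := by
  refine (((h.deriv₁ θ hθ).div (h.deriv θ hθ) hf).div_const β).congr_deriv ?_
  rw [div_div, mul_comm β]
  ring

/-- Near `π/2` the profile is comparable to `π/2 - θ`. -/
theorem tendsto_log_ratio (h : IsAngularSolution q c n β f f₁ f₂) (hend : f (Real.pi / 2) = 0)
    (hend₁ : f₁ (Real.pi / 2) < 0) :
    Tendsto (fun θ => Real.log (f θ / (Real.pi / 2 - θ))) (𝓝[<] (Real.pi / 2))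
      (𝓝 (Real.log (-f₁ (Real.pi / 2)))) := by
  have hpi := Real.pi_pos
  have h1 : (Real.pi / 2) ∈ Icc 0 (Real.pi / 2) := ⟨by positivity, le_rfl⟩
  have hle : 𝓝[<] (Real.pi / 2) ≤ 𝓝[Icc 0 (Real.pi / 2) \ {Real.pi / 2}] (Real.pi / 2) := by
    rw [← nhdsWithin_Ioo_eq_nhdsLT (show (0 : ℝ) < Real.pi / 2 by positivity)]
    exact nhdsWithin_mono _ fun s hs => ⟨Ioo_subset_Icc_self hs, hs.2.ne⟩
  have h2 := ((hasDerivWithinAt_iff_tendsto_slope.1 (h.deriv _ h1)).mono_left hle).neg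
  refine (h2.log (by linarith)).congr' ?_
  filter_upwards [self_mem_nhdsWithin] with s hs
  have : s - Real.pi / 2 ≠ 0 := sub_ne_zero.2 (ne_of_lt hs)
  rw [slope_def_field, hend, sub_zero, ← div_neg, neg_sub]

end IsAngularSolution

/-- A one-sided second-derivative test: `x = w'` vanishes at `θ` with negative slope, so `w`
decreases strictly just to the right. Looking only to the right lets it apply at the left end point
as well. -/
theorem exists_gt_of_hasDerivWithinAt_neg {w x : ℝ → ℝ} {a b θ d : ℝ} (hθ : θ ∈ Ico a b)
    (hw : ∀ s ∈ Ico a b, HasDerivWithinAt w (x s) (Icc a b) s) (hx0 : x θ = 0)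
    (hx : HasDerivWithinAt x d (Icc a b) θ) (hd : d < 0) {r : ℝ} (hr : θ < r) :
    ∃ s ∈ Ioo θ r, w s < w θ := by
  have hle : 𝓝[>] θ ≤ 𝓝[Icc a b \ {θ}] θ := by
    rw [← nhdsWithin_Ioo_eq_nhdsGT hθ.2]
    exact nhdsWithin_mono _ fun s hs => ⟨⟨hθ.1.trans hs.1.le, hs.2.le⟩, hs.1.ne'⟩
  have h1 := ((hasDerivWithinAt_iff_tendsto_slope.1 hx).mono_left hle).eventually_lt_const hd
  have h2 : ∀ᶠ s in 𝓝[>] θ, x s < 0 := by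
    filter_upwards [h1, self_mem_nhdsWithin] with s hs hθs
    rw [slope_def_field, hx0, sub_zero, div_lt_iff₀ (sub_pos.2 hθs), zero_mul] at hs
    exact hs
  obtain ⟨u, hu, hsub⟩ := (mem_nhdsGT_iff_exists_Ioo_subset (a := θ)).1 h2
  set s := (θ + min u (min r b)) / 2 with hs
  have hm : θ < min u (min r b) := lt_min hu (lt_min hr hθ.2)
  have hs1 : θ < s := by rw [hs]; linarith
  have hs2 : s < min u (min r b) := by rw [hs]; linarith
  have hsu : s < u := hs2.trans_le (min_le_left _ _)
  have hsr : s < r := hs2.trans_le ((min_le_right _ _).trans (min_le_left _ _))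
  have hsb : s < b := hs2.trans_le ((min_le_right _ _).trans (min_le_right _ _))
  refine ⟨s, ⟨hs1, hsr⟩, ?_⟩
  have hanti : StrictAntiOn w (Icc θ s) := by
    refine strictAntiOn_of_deriv_neg (convex_Icc θ s) (fun y hy => ?_) fun y hy => ?_
    · exact (hw y ⟨hθ.1.trans hy.1, hy.2.trans_lt hsb⟩).continuousWithinAt.mono
        (Icc_subset_Icc hθ.1 hsb.le)
    · rw [interior_Icc] at hy
      have := (hw y ⟨hθ.1.trans hy.1.le, hy.2.trans hsb⟩).hasDerivAt
        (Icc_mem_nhds (hθ.1.trans_lt hy.1) (hy.2.trans hsb))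
      rw [this.deriv]
      exact hsub ⟨hy.1, hy.2.trans hsu⟩
  exact hanti (left_mem_Icc.2 hs1.le) (right_mem_Icc.2 hs1.le) hs1

/-- Two positive profiles vanishing to first order at `π/2` cannot have different exponents. -/
theorem IsAngularSolution.not_lt {f f₁ f₂ g g₁ g₂ : ℝ → ℝ} {q c n β γ : ℝ}
    (hf : IsAngularSolution q c n β f f₁ f₂) (hg : IsAngularSolution q c n γ g g₁ g₂)
    (hq : 0 < q) (hn : 0 ≤ n) (hβ : 0 < β)
    (hfpos : ∀ θ ∈ Ico 0 (Real.pi / 2), 0 < f θ) (hgpos : ∀ θ ∈ Ico 0 (Real.pi / 2), 0 < g θ)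
    (hfend : f (Real.pi / 2) = 0) (hgend : g (Real.pi / 2) = 0)
    (hfend₁ : f₁ (Real.pi / 2) < 0) (hgend₁ : g₁ (Real.pi / 2) < 0) : ¬ β < γ := by
  intro hlt
  have hγ : 0 < γ := hβ.trans hlt
  have hpi := Real.pi_pos
  set w : ℝ → ℝ := fun θ => Real.log (g θ) / γ - Real.log (f θ) / β with hw
  set x : ℝ → ℝ := fun θ => g₁ θ / g θ / γ - f₁ θ / f θ / β with hx
  have hwd : ∀ s ∈ Ico 0 (Real.pi / 2), HasDerivWithinAt w (x s) (Icc 0 (Real.pi / 2)) s :=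
    fun s hs => (hg.hasDerivWithinAt_log (Ico_subset_Icc_self hs) (hgpos s hs).ne').sub
      (hf.hasDerivWithinAt_log (Ico_subset_Icc_self hs) (hfpos s hs).ne')
  have hxd := fun s (hs : s ∈ Ico 0 (Real.pi / 2)) =>
    (hg.hasDerivWithinAt_logDeriv (Ico_subset_Icc_self hs) (hgpos s hs).ne').sub
      (hf.hasDerivWithinAt_logDeriv (Ico_subset_Icc_self hs) (hfpos s hs).ne')
  -- Both profiles are comparable to `π/2 - θ`, so `w` behaves like `(1/γ - 1/β) log (π/2 - θ)`,
  -- with a negative coefficient.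
  have hlim : Tendsto w (𝓝[<] (Real.pi / 2)) atTop := by
    have h1 := ((hg.tendsto_log_ratio hgend hgend₁).div_const γ).sub
      ((hf.tendsto_log_ratio hfend hfend₁).div_const β)
    have h2 : Tendsto (fun θ => Real.log (Real.pi / 2 - θ)) (𝓝[<] (Real.pi / 2)) atBot := by
      refine Real.tendsto_log_nhdsGT_zero.comp ?_
      refine tendsto_nhdsWithin_iff.2 ⟨?_, ?_⟩
      · have : Continuous fun θ : ℝ => Real.pi / 2 - θ := by fun_prop
        simpa using (this.tendsto (Real.pi / 2)).mono_left nhdsWithin_le_nhds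
      · filter_upwards [self_mem_nhdsWithin] with s hs
        exact sub_pos.2 (mem_Iio.1 hs)
    have h3 : 1 / γ - 1 / β < 0 := sub_neg.2 (one_div_lt_one_div_of_lt hβ hlt)
    refine (h1.add_atTop (h2.atBot_mul_const_of_neg h3)).congr' ?_
    filter_upwards [Ioo_mem_nhdsLT (show (0 : ℝ) < Real.pi / 2 by positivity)] with s hs
    have hs' := sub_pos.2 hs.2
    rw [Real.log_div (hgpos s (Ioo_subset_Ico_self hs)).ne' hs'.ne',
      Real.log_div (hfpos s (Ioo_subset_Ico_self hs)).ne' hs'.ne']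
    simp only [hw]
    ring
  -- As `w b > 0 = w 0`, the minimum over `[0, b]` is not attained at `b`.
  obtain ⟨b, hwb, hb⟩ := ((hlim.eventually_gt_atTop 0).and
    (Ioo_mem_nhdsLT (show (0 : ℝ) < Real.pi / 2 by positivity))).exists
  have hsub : ∀ s ∈ Icc 0 b, s ∈ Ico 0 (Real.pi / 2) := fun s hs => ⟨hs.1, hs.2.trans_lt hb.2⟩
  have hcont : ContinuousOn w (Icc 0 b) := fun s hs =>
    (hwd s (hsub s hs)).continuousWithinAt.mono (Icc_subset_Icc_right hb.2.le)
  obtain ⟨θ, hθ, hmin⟩ := isCompact_Icc.exists_isMinOn (nonempty_Icc.2 hb.1.le) hcont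
  have hw0 : w 0 = 0 := by simp [hw, hf.zero, hg.zero]
  have hθb : θ < b := by
    refine lt_of_le_of_ne hθ.2 ?_
    rintro rfl
    have := isMinOn_iff.1 hmin 0 ⟨le_rfl, hb.1.le⟩
    linarith
  have hθ' := hsub θ hθ
  -- The second component is `w''`. At the pole it comes from `second_deriv_zero`; inside, equal
  -- logarithmic slopes `G` make the two Riccati equations differ only by `q (γ - β)(1 + G²)²`.
  have hx0 : x θ = 0 ∧ ((g₂ θ * g θ - g₁ θ ^ 2) / (γ * g θ ^ 2) -
      (f₂ θ * f θ - f₁ θ ^ 2) / (β * f θ ^ 2)) < 0 := by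
    rcases hθ.1.eq_or_lt with h0 | h0
    · subst h0
      refine ⟨by simp [hx, hf.zero₁, hg.zero₁], ?_⟩
      have e1 := hf.second_deriv_zero hβ.ne'
      have e2 := hg.second_deriv_zero hγ.ne'
      have hn1 : n + 1 ≠ 0 := by positivity
      rw [hf.zero, hg.zero, hf.zero₁, hg.zero₁]
      have e3 : g₂ 0 = -(γ * (q * γ + c)) / (n + 1) := by field_simp; linarith
      have e4 : f₂ 0 = -(β * (q * β + c)) / (n + 1) := by field_simp; linarith
      rw [e3, e4]
      have e5 : (-(γ * (q * γ + c)) / (n + 1) * 1 - 0 ^ 2) / (γ * 1 ^ 2) -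
          (-(β * (q * β + c)) / (n + 1) * 1 - 0 ^ 2) / (β * 1 ^ 2) =
          q * (β - γ) / (n + 1) := by field_simp; ring
      rw [e5]
      exact div_neg_of_neg_of_pos (mul_neg_of_pos_of_neg hq (by linarith)) (by positivity)
    · have hθo : θ ∈ Ioo 0 (Real.pi / 2) := ⟨h0, hθ'.2⟩
      have hloc : IsLocalMin w θ := by
        filter_upwards [Icc_mem_nhds h0 hθb] with s hs using isMinOn_iff.1 hmin s hs
      have hxz : x θ = 0 := hloc.hasDerivAt_eq_zero
        ((hwd θ hθ').hasDerivAt (Icc_mem_nhds h0 hθ'.2))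
      refine ⟨hxz, ?_⟩
      have hfθ := hfpos θ hθ'
      have hgθ := hgpos θ hθ'
      set G := -(f₁ θ / f θ / β) with hG
      have e1 := hf.riccati hβ.ne' hθo hfθ.ne' (G := G) (by rw [hG]; field_simp)
      have e2 := hg.riccati hγ.ne' hθo hgθ.ne' (G := G) (by
        have : g₁ θ / g θ / γ = -G := by rw [hG]; simp only [hx] at hxz; linarith
        field_simp at this
        linarith)
      have hpos1 : 0 < 1 + q * G ^ 2 := by positivity
      have hpos2 : 0 < (1 + G ^ 2) ^ 2 := by positivity
      refine neg_of_mul_neg_left ?_ hpos1.le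
      rw [sub_mul]
      have : q * (β - γ) * (1 + G ^ 2) ^ 2 < 0 :=
        mul_neg_of_neg_of_pos (mul_neg_of_pos_of_neg hq (by linarith)) hpos2
      linarith
  obtain ⟨s, hs, hws⟩ := exists_gt_of_hasDerivWithinAt_neg hθ' hwd hx0.1 (hxd θ hθ') hx0.2 hθb
  exact (isMinOn_iff.1 hmin s ⟨hθ.1.trans hs.1.le, hs.2.le⟩).not_gt hws

/-! ### From `p`-harmonicity to the angular equation -/

section Converse

variable {N : ℕ}

theorem MemLpLoc.locallyIntegrableOn {G : Type*} [NormedAddCommGroup G] {p : ℝ} (hp : 1 ≤ p)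
    {Ω : Set (EuclideanSpace ℝ (Fin N))} (hΩ : IsOpen Ω) {g : EuclideanSpace ℝ (Fin N) → G}
    (hg : MemLpLoc p Ω g) : LocallyIntegrableOn g Ω := by
  rw [locallyIntegrableOn_iff hΩ.isLocallyClosed]
  intro K hKΩ hK
  have : IsFiniteMeasure (volume.restrict K) := ⟨by
    rw [Measure.restrict_apply_univ]; exact hK.measure_lt_top⟩
  exact (hg K hK hKΩ).integrable (ENNReal.one_le_ofReal.2 hp)

theorem MeasureTheory.LocallyIntegrableOn.integrable_mul_inner {F : Type*} [NormedAddCommGroup F]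
    [InnerProductSpace ℝ F] [FiniteDimensional ℝ F] [MeasurableSpace F] [BorelSpace F] {Ω : Set F}
    {g : F → F} (hg : LocallyIntegrableOn g Ω) {φ : F → ℝ} (hφ : Continuous φ)
    (hc : HasCompactSupport φ) (hsub : tsupport φ ⊆ Ω) (v : F) :
    Integrable fun x => φ x * inner ℝ (g x) v := by
  have h1 : IntegrableOn g (tsupport φ) := hg.integrableOn_compact_subset hsub hc.isCompact
  have h2 : IntegrableOn (fun x => φ x * inner ℝ (g x) v) (tsupport φ) :=
    IntegrableOn.continuousOn_mul hφ.continuousOn (h1.inner_const v) hc.isCompact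
  refine (integrableOn_iff_integrable_of_support_subset fun x hx => ?_).1 h2
  exact subset_tsupport φ fun h => hx (by simp [h])

/-- Weak gradients are unique almost everywhere. -/
theorem IsWeakGradient.ae_eq {Ω : Set (EuclideanSpace ℝ (Fin N))} (hΩ : IsOpen Ω)
    {u : EuclideanSpace ℝ (Fin N) → ℝ} {g G : EuclideanSpace ℝ (Fin N) → EuclideanSpace ℝ (Fin N)}
    (hg : IsWeakGradient Ω u g) (hG : IsWeakGradient Ω u G) (hgi : LocallyIntegrableOn g Ω)
    (hGi : LocallyIntegrableOn G Ω) : ∀ᵐ x, x ∈ Ω → g x = G x := by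
  have key : ∀ i, ∀ᵐ x, x ∈ Ω →
      inner ℝ (g x) (EuclideanSpace.single i (1 : ℝ)) -
        inner ℝ (G x) (EuclideanSpace.single i (1 : ℝ)) = 0 := by
    intro i
    set v : EuclideanSpace ℝ (Fin N) := EuclideanSpace.single i (1 : ℝ)
    have hli : LocallyIntegrableOn (fun x => inner ℝ (g x) v - inner ℝ (G x) v) Ω := by
      have h1 := hgi.sub hGi
      intro x hx
      obtain ⟨t, ht, hi⟩ := h1 x hx
      refine ⟨t, ht, (hi.inner_const v).congr (Eventually.of_forall fun y => ?_)⟩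
      simp [inner_sub_left]
    refine hΩ.ae_eq_zero_of_integral_contDiff_smul_eq_zero hli fun φ hφ hc hsub => ?_
    have h1 := hg φ hφ hc hsub v
    rw [hG φ hφ hc hsub v, neg_inj,
      setIntegral_eq_integral_of_forall_compl_eq_zero (fun x hx => by
        rw [image_eq_zero_of_notMem_tsupport fun h => hx (hsub h), zero_mul]),
      setIntegral_eq_integral_of_forall_compl_eq_zero (fun x hx => by
        rw [image_eq_zero_of_notMem_tsupport fun h => hx (hsub h), zero_mul])] at h1
    simp only [smul_eq_mul, mul_sub]
    rw [integral_sub (hgi.integrable_mul_inner hφ.continuous hc hsub v)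
      (hGi.integrable_mul_inner hφ.continuous hc hsub v), h1, sub_self]
  filter_upwards [ae_all_iff.2 key] with x hx hxΩ
  ext i
  have := hx i hxΩ
  simpa [EuclideanSpace.inner_single_right, sub_eq_zero] using this

theorem exists_cosTo_eq (hN : 2 ≤ N) {t : ℝ} (ht : t ∈ Ioo (0 : ℝ) 1) :
    ∃ x ∈ offAxis (lastVector hN), cosTo (lastVector hN) x = t := by
  set e := lastVector hN
  have he : ‖e‖ = 1 := norm_lastVector hN
  set e' : EuclideanSpace ℝ (Fin N) := EuclideanSpace.single ⟨0, by omega⟩ (1 : ℝ)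
  have he' : ‖e'‖ = 1 := by simp [e']
  have hee' : inner ℝ e e' = 0 := by
    rw [inner_lastVector]
    simp only [e', lastIndex, PiLp.single_apply]
    rw [if_neg]
    simp [Fin.ext_iff]; omega
  have hs2 : √(1 - t ^ 2) ^ 2 = 1 - t ^ 2 := Real.sq_sqrt (by nlinarith [ht.1, ht.2])
  set x := t • e + √(1 - t ^ 2) • e'
  have h1 : inner ℝ e x = t := by
    simp [x, inner_add_right, inner_smul_right, hee', he]
  have h2 : ‖x‖ = 1 := by
    have : ‖x‖ ^ 2 = 1 := by
      rw [← real_inner_self_eq_norm_sq]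
      simp only [x, inner_add_right, inner_add_left, inner_smul_right, inner_smul_left, hee',
        real_inner_comm e e', real_inner_self_eq_norm_sq, he, he', conj_trivial]
      linarith
    nlinarith [norm_nonneg x]
  exact ⟨x, ⟨by rw [h1]; exact ht.1, by rw [h1, h2]; exact ht.2⟩, by rw [cosTo, h1, h2, div_one]⟩

/-- The profile of a `p`-harmonic quasiradial function solves the angular equation. -/
theorem IsRegularProfile.angularOp_eq_zero {f f₁ f₂ : ℝ → ℝ} (h : IsRegularProfile f f₁ f₂)
    {p k : ℝ} (hp : 1 ≤ p) (hN : 2 ≤ N) (hk : k ≠ 0)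
    (hharm : IsPHarmonic p (upperHalfSpace N hN) (quasiradial N hN k f)) {θ : ℝ}
    (hθ : θ ∈ Ioo 0 (Real.pi / 2)) :
    angularOp (p - 1) (p - N) (N - 2) (-k) θ (f θ) (f₁ θ) (f₂ θ) = 0 := by
  rw [upperHalfSpace_eq, quasiradial_eq] at hharm
  obtain ⟨g, -, hgp, hgw, hgd⟩ := hharm
  set e := lastVector hN
  have he : ‖e‖ = 1 := norm_lastVector hN
  have hfin : Module.finrank ℝ (EuclideanSpace ℝ (Fin N)) = N := by simp
  set w : ℝ → ℝ := fun t => f (Real.arccos t)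
  set w₁ := cosProfileDeriv f₁ f₂
  have hGc := h.continuousOn_grad he k
  -- The weak gradient in the hypothesis may be replaced by the classical, continuous one.
  have hae := hgw.ae_eq (isOpen_halfSpace e)
    (isWeakGradient_of_hasFDerivAt (isOpen_halfSpace e) (fun x hx => h.hasFDerivAt he k hx) hGc)
    (hgp.locallyIntegrableOn hp (isOpen_halfSpace e))
    (hGc.locallyIntegrableOn (isOpen_halfSpace e).measurableSet)
  obtain ⟨hQ1, hP1⟩ := h.contDiffOn_flux p hk
  set m := (k - 1) * (p - 1) with hm
  set a : EuclideanSpace ℝ (Fin N) → ℝ :=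
    fun x => ‖x‖ ^ (m - 1) * radialFlux p k w w₁ (cosTo e x)
  set b : EuclideanSpace ℝ (Fin N) → ℝ := fun x => ‖x‖ ^ m * axialFlux p k w w₁ (cosTo e x)
  have ha : ContDiffOn ℝ 1 a (offAxis e) := contDiffOn_homogeneous hP1 (m - 1)
  have hb : ContDiffOn ℝ 1 b (offAxis e) := contDiffOn_homogeneous hQ1 m
  -- `D` is the divergence of the flux. Testing off the axis gives `D = 0` almost everywhere, and
  -- continuity makes this pointwise.
  set D : EuclideanSpace ℝ (Fin N) → ℝ := fun x =>
    Module.finrank ℝ (EuclideanSpace ℝ (Fin N)) * a x + fderiv ℝ a x x + fderiv ℝ b x e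
  have hDc : ContinuousOn D (offAxis e) :=
    ((continuousOn_const.mul ha.continuousOn).add
      ((ha.continuousOn_fderiv_of_isOpen (isOpen_offAxis e) le_rfl).clm_apply continuousOn_id)).add
      ((hb.continuousOn_fderiv_of_isOpen (isOpen_offAxis e) le_rfl).clm_apply continuousOn_const)
  have hDae : ∀ᵐ x, x ∈ offAxis e → D x = 0 := by
    refine (isOpen_offAxis e).ae_eq_zero_of_integral_contDiff_smul_eq_zero
      (hDc.locallyIntegrableOn (isOpen_offAxis e).measurableSet) fun φ hφ hc hsub => ?_
    have hsub' := hsub.trans (offAxis_subset e)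
    have h1 := hgd φ hφ hc hsub'
    have h2 : ∫ x in halfSpace e, inner ℝ (‖g x‖ ^ (p - 2) • g x) (gradient φ x) =
        ∫ x in halfSpace e, (a x * fderiv ℝ φ x x + b x * fderiv ℝ φ x e) := by
      refine setIntegral_congr_ae (isOpen_halfSpace e).measurableSet ?_
      filter_upwards [hae] with x hx hxΩ
      rw [hx hxΩ]
      exact h.inner_flux_gradient he p hk hsub' x
    rw [h2, setIntegral_eq_integral_of_forall_compl_eq_zero (fun x hx => by
      rw [fderiv_of_notMem_tsupport ℝ fun h => hx (hsub' h)]; simp),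
      integral_field_eq_neg_integral_div (isOpen_offAxis e) ha hb
        (hφ.of_le (by exact_mod_cast le_top)) hc hsub e, neg_eq_zero] at h1
    exact h1
  have hD0 : EqOn D 0 (offAxis e) := by
    refine Measure.eqOn_open_of_ae_eq (μ := volume) ?_ (isOpen_offAxis e) hDc continuousOn_const
    exact (ae_restrict_iff' (isOpen_offAxis e).measurableSet).2 hDae
  have ht : Real.cos θ ∈ Ioo (0 : ℝ) 1 :=
    ⟨Real.cos_pos_of_mem_Ioo ⟨by linarith [hθ.1, Real.pi_pos], hθ.2⟩, by
      have := Real.cos_lt_cos_of_nonneg_of_le_pi_div_two le_rfl hθ.2.le hθ.1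
      rwa [Real.cos_zero] at this⟩
  -- One point at angle `θ` suffices: there `D` is a nonzero multiple of the angular operator.
  obtain ⟨x, hx, hxt⟩ := exists_cosTo_eq hN ht
  have hx0 := ne_zero_of_mem_halfSpace (offAxis_subset e hx)
  have hderiv : ∀ {R : ℝ → ℝ}, ContDiffOn ℝ 1 R (Ioo 0 1) →
      HasDerivAt R (_root_.deriv R (cosTo e x)) (cosTo e x) := fun hR =>
    ((hR.differentiableOn one_ne_zero).differentiableAt
      (Ioo_mem_nhds (hxt ▸ ht.1) (hxt ▸ ht.2))).hasDerivAt
  have h3 := hD0 hx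
  simp only [D, Pi.zero_apply] at h3
  rw [div_homogeneous_field he hx0 m (P₁ := _root_.deriv (radialFlux p k w w₁))
    (Q₁ := _root_.deriv (axialFlux p k w w₁)) (hderiv hP1) (hderiv hQ1), hxt, hfin] at h3
  obtain ⟨c, hc, hceq⟩ := h.exists_hasDerivAt_axialFlux p hk N ht
  rw [hceq, Real.arccos_cos hθ.1.le (by linarith [hθ.2, Real.pi_pos])] at h3
  have hr : ‖x‖ ^ (m - 1) ≠ 0 := (Real.rpow_pos_of_pos (norm_pos_iff.2 hx0) _).ne'
  exact (mul_eq_zero.1 ((mul_eq_zero.1 h3).resolve_left hr)).resolve_left hc.ne'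

end Converse

/-! ### Translation of the profile conditions and conclusion -/

theorem IsAngularProfile.isRegularProfile {f : ℝ → ℝ} (h : IsAngularProfile f) :
    IsRegularProfile f (derivWithin f (Icc 0 (Real.pi / 2)))
      (derivWithin (derivWithin f (Icc 0 (Real.pi / 2))) (Icc 0 (Real.pi / 2))) := by
  have hu : UniqueDiffOn ℝ (Icc 0 (Real.pi / 2)) := uniqueDiffOn_Icc (by positivity)
  have h2 := h.contDiffOn
  rw [show (2 : WithTop ℕ∞) = 1 + 1 by norm_num, contDiffOn_succ_iff_derivWithin hu] at h2
  have h1 := h2.2.2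
  rw [show (1 : WithTop ℕ∞) = 0 + 1 by norm_num, contDiffOn_succ_iff_derivWithin hu] at h1
  exact ⟨fun θ hθ => (h2.1 θ hθ).hasDerivWithinAt, fun θ hθ => (h1.1 θ hθ).hasDerivWithinAt,
    contDiffOn_zero.1 h1.2.2, h.deriv_zero, h.pos⟩

theorem IsAngularProfile.isAngularSolution {f : ℝ → ℝ} (h : IsAngularProfile f) {p k : ℝ}
    (hp : 1 ≤ p) {N : ℕ} (hN : 2 ≤ N) (hk : k ≠ 0)
    (hharm : IsPHarmonic p (upperHalfSpace N hN) (quasiradial N hN k f)) :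
    IsAngularSolution (p - 1) (p - N) (N - 2) (-k) f (derivWithin f (Icc 0 (Real.pi / 2)))
      (derivWithin (derivWithin f (Icc 0 (Real.pi / 2))) (Icc 0 (Real.pi / 2))) :=
  have hr := h.isRegularProfile
  ⟨hr.deriv, hr.deriv₁, hr.cont₂, fun _ hθ => hr.angularOp_eq_zero hp hN hk hharm hθ,
    h.value_zero, h.deriv_zero⟩

theorem IsAngularSolution.isAngularProfile {q c n β : ℝ} {f f₁ f₂ : ℝ → ℝ}
    (h : IsAngularSolution q c n β f f₁ f₂) (hpos : ∀ θ ∈ Ico 0 (Real.pi / 2), 0 < f θ)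
    (hneg : ∀ θ ∈ Ioc 0 (Real.pi / 2), f₁ θ < 0) (hend : f (Real.pi / 2) = 0) :
    IsAngularProfile f := by
  have hpi : (0 : ℝ) < Real.pi / 2 := by positivity
  have hu : UniqueDiffOn ℝ (Icc 0 (Real.pi / 2)) := uniqueDiffOn_Icc hpi
  have hd : ∀ θ ∈ Icc 0 (Real.pi / 2), derivWithin f (Icc 0 (Real.pi / 2)) θ = f₁ θ :=
    fun θ hθ => (h.deriv θ hθ).derivWithin (hu θ hθ)
  have hd₁ : ∀ θ ∈ Icc 0 (Real.pi / 2), derivWithin f₁ (Icc 0 (Real.pi / 2)) θ = f₂ θ :=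
    fun θ hθ => (h.deriv₁ θ hθ).derivWithin (hu θ hθ)
  refine ⟨hpos, ?_, ?_, h.zero, ?_, hend, ?_⟩
  · refine strictAntiOn_of_deriv_neg (convex_Icc _ _)
      (fun θ hθ => (h.deriv θ hθ).continuousWithinAt) fun θ hθ => ?_
    rw [interior_Icc] at hθ
    rw [((h.deriv θ (Ioo_subset_Icc_self hθ)).hasDerivAt (Icc_mem_nhds hθ.1 hθ.2)).deriv]
    exact hneg θ (Ioo_subset_Ioc_self hθ)
  · have h1 : ContDiffOn ℝ 1 f₁ (Icc 0 (Real.pi / 2)) := by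
      rw [show (1 : WithTop ℕ∞) = 0 + 1 by norm_num, contDiffOn_succ_iff_derivWithin hu]
      exact ⟨fun θ hθ => (h.deriv₁ θ hθ).differentiableWithinAt, by simp,
        contDiffOn_zero.2 (h.cont₂.congr hd₁)⟩
    rw [show (2 : WithTop ℕ∞) = 1 + 1 by norm_num, contDiffOn_succ_iff_derivWithin hu]
    exact ⟨fun θ hθ => (h.deriv θ hθ).differentiableWithinAt, by simp, h1.congr hd⟩
  · rw [hd 0 ⟨le_rfl, hpi.le⟩, h.zero₁]
  · rw [hd _ ⟨hpi.le, le_rfl⟩]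
    exact hneg _ ⟨hpi, le_rfl⟩

theorem theorem1p2 (p : ℝ) (hp : 1 < p) (N : ℕ) (hN : 2 ≤ N) :
    ∃! k : ℝ, k < 0 ∧ ∃ f : ℝ → ℝ, IsAngularProfile f ∧
      IsPHarmonic p (upperHalfSpace N hN) (quasiradial N hN k f) := by
  have hq : 0 < p - 1 := by linarith
  -- The L'Hôpital step at the pole uses a natural exponent, while the angular equation uses the
  -- real number `N - 2`.
  have hn : ((N - 2 : ℕ) : ℝ) = N - 2 := by push_cast [Nat.cast_sub hN]; ring
  refine existsUnique_of_exists_of_unique ?_ ?_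
  · obtain ⟨β, hβ, -, C, φ, hφ⟩ :=
      exists_isPhase hq (p - N) (Nat.cast_nonneg (α := ℝ) (N - 2))
    obtain ⟨f, f₁, f₂, hsol, hpos, hneg, hend⟩ := hφ.exists_profile hq hβ
    rw [hn] at hsol
    refine ⟨-β, by linarith, f, hsol.isAngularProfile hpos hneg hend, ?_⟩
    refine (IsRegularProfile.mk hsol.deriv hsol.deriv₁ hsol.cont₂ hsol.zero₁ hpos).isPHarmonic hN
      (by linarith) fun θ hθ => ?_
    rw [neg_neg]
    exact hsol.ode θ hθ
  -- The comparison excludes strict inequality in one direction; exchanging the roles of the two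
  -- profiles excludes the other.
  · have aux : ∀ k l : ℝ, (k < 0 ∧ ∃ f : ℝ → ℝ, IsAngularProfile f ∧
        IsPHarmonic p (upperHalfSpace N hN) (quasiradial N hN k f)) →
        (l < 0 ∧ ∃ f : ℝ → ℝ, IsAngularProfile f ∧
          IsPHarmonic p (upperHalfSpace N hN) (quasiradial N hN l f)) → ¬ -k < -l := by
      rintro k l ⟨hk, f, hf, hfh⟩ ⟨hl, g, hg, hgh⟩
      have hn0 : (0 : ℝ) ≤ N - 2 := by rw [← hn]; positivity
      exact (hf.isAngularSolution hp.le hN hk.ne hfh).not_lt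
        (hg.isAngularSolution hp.le hN hl.ne hgh) hq hn0 (by linarith) hf.pos hg.pos
        hf.value_end hg.value_end hf.deriv_end hg.deriv_end
    intro k l hk hl
    have h1 := aux k l hk hl
    have h2 := aux l k hl hk
    exact le_antisymm (by linarith) (by linarith)
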